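/- A univariate polynomial with real coefficients is called *hyperbolic* if it is not identically zero and all its complex zeros are real. A polynomial $f\in\mathbb{R}[z,w]$ is called *real stable* if $f(z,w)\neq 0$ for all $(z,w)\in\mathbb{C}^2$ with $\Im z>0$ and $\Im w>0$. A linear operator $T:\mathbb{R}[z]\to\mathbb{R}[z]$ *preserves hyperbolicity* if $T(f)$ is hyperbolic or identically zero for every hyperbolic $f\in\mathbb{R}[z]$. Every linear operator $T:\mathbb{R}[z]\to\mathbb{R}[z]$ is extended to a linear operator on $\mathbb{R}[z,w]$, again denoted by $T$, by $T(z^kw^\ell)=T(z^k)w^\ell$ for all integers $k,\ell\ge 0$. Let $P,Q$ be hyperbolic polynomials with zeros $\alpha_1\le\dots\le\alpha_n$ and $\beta_1\le\dots\le\beta_m$, respectively, counted with multiplicity. The zeros of $P$ and $Q$ *interlace* if either $\alpha_1\le\beta_1\le\alpha_2\le\beta_2\le\cdots$ with $m\in\{n-1,n\}$, or $\beta_1\le\alpha_1\le\beta_2\le\alpha_2\le\cdots$ with $n\in\{m-1,m\}$; in particular, the zeros of any two hyperbolic polynomials of degree $0$ or $1$ interlace. **Corollary 2.6 (Algebraic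 characterization of hyperbolicity preservers).** A linear operator $T:\mathbb{R}[z]\to\mathbb{R}[z]$ preserves hyperbolicity if and only if at least one of the following holds: (a) $T$ has range of dimension at most two and is of the form $$T(f)=\alpha(f)P+\beta(f)Q,\qquad f\in\mathbb{R}[z],$$ where $\alpha,\beta:\mathbb{R}[z]\to\mathbb{R}$ are linear functionals and $P,Q\in\mathbb{R}[z]$ are hyperbolic polynomials whose zeros interlace; (b) for every integer $n\ge 0$, the polynomial $T[(z+w)^n]$ is real stable or identically zero; (c) for every integer $n\ge 0$, the polynomial $T[(z-w)^n]$ is real stable or identically zero. -/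

import Mathlib

open Polynomial

namespace AlgHyp

/-- A univariate real polynomial is hyperbolic if it is non-zero and all its complex zeros
are real. This is the class `H_1(ℝ)`. -/
def Hyperbolic (f : ℝ[X]) : Prop :=
  f ≠ 0 ∧ ∀ z : ℂ, aeval z f = 0 → z.im = 0

/-- A real polynomial in `n` variables is real stable if it does not vanish at any point of `ℂⁿ`
all of whose coordinates have positive imaginary part. This is the class `H_n(ℝ)`. -/
def RealStable {n : ℕ} (f : MvPolynomial (Fin n) ℝ) : Prop :=
  ∀ z : Fin n → ℂ, (∀ j, 0 < (z j).im) → MvPolynomial.aeval z f ≠ 0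

/-- `T` preserves hyperbolicity: it maps `H_1(ℝ)` into `H_1(ℝ) ∪ {0}`. -/
def PreservesHyperbolicity (T : ℝ[X] →ₗ[ℝ] ℝ[X]) : Prop :=
  ∀ f : ℝ[X], Hyperbolic f → Hyperbolic (T f) ∨ T f = 0

/-- The extension of `T` to `ℝ[z, w]` (`z` is the variable `0`, `w` is the variable `1`):
the linear operator with `T (z ^ k * w ^ l) = T (z ^ k) * w ^ l`, see `extend_monomial`. -/
noncomputable def extend (T : ℝ[X] →ₗ[ℝ] ℝ[X]) :
    MvPolynomial (Fin 2) ℝ →ₗ[ℝ] MvPolynomial (Fin 2) ℝ :=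
  (MvPolynomial.basisMonomials (Fin 2) ℝ).constr ℝ fun d =>
    aeval (MvPolynomial.X 0 : MvPolynomial (Fin 2) ℝ) (T (X ^ d 0)) * MvPolynomial.X 1 ^ d 1

theorem extend_monomial (T : ℝ[X] →ₗ[ℝ] ℝ[X]) (k l : ℕ) :
    extend T (MvPolynomial.X 0 ^ k * MvPolynomial.X 1 ^ l) =
      aeval (MvPolynomial.X 0 : MvPolynomial (Fin 2) ℝ) (T (X ^ k)) * MvPolynomial.X 1 ^ l := by
  have h : (MvPolynomial.X 0 ^ k * MvPolynomial.X 1 ^ l : MvPolynomial (Fin 2) ℝ) =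
      MvPolynomial.basisMonomials (Fin 2) ℝ (Finsupp.single 0 k + Finsupp.single 1 l) := by
    simp [MvPolynomial.X_pow_eq_monomial, MvPolynomial.monomial_mul]
  rw [h, extend, Module.Basis.constr_basis]
  simp

/-- For lists `a = [a₁, …, aₙ]` and `b = [b₁, …, bₘ]`, the two lists are exhausted by the
alternating chain `a₁ ≤ b₁ ≤ a₂ ≤ b₂ ≤ ⋯` (so `m = n` or `m + 1 = n`). -/
def Alternates (a b : List ℝ) : Prop :=
  (a.length = b.length ∨ a.length = b.length + 1) ∧
  (∀ (i : ℕ) (ha : i < a.length) (hb : i < b.length), a[i] ≤ b[i]) ∧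
  (∀ (i : ℕ) (hb : i < b.length) (ha : i + 1 < a.length), b[i] ≤ a[i + 1])

/-- The real zeros of `f` in increasing order, repeated according to multiplicity. -/
noncomputable def sortedZeros (f : ℝ[X]) : List ℝ :=
  f.roots.sort (· ≤ ·)

/-- The zeros of `f` and `g` interlace (used for hyperbolic `f`, `g`). Two polynomials of degree
`0` or `1` always satisfy this, in accordance with the usual convention. -/
def ZerosInterlace (f g : ℝ[X]) : Prop :=
  Alternates (sortedZeros f) (sortedZeros g) ∨ Alternates (sortedZeros g) (sortedZeros f)

end AlgHyp

/-! Sufficiency of (b). For fixed `z` in the upper half-plane, `f ↦ (T f)(z)` is a linear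
functional, and stability of the symbol says that it does not vanish on powers `(X + w) ^ n` with `0
< w.im`. Grace's theorem (`grace`), obtained by iterating Laguerre's theorem on polar derivatives,
extends this to products of factors `X + wᵢ` with different `wᵢ`. A hyperbolic `f` is, up to a
constant, such a product with real `wᵢ`; shifting them upwards and passing to the limit by Hurwitz
gives `preservesHyperbolicity_of_symbol`. Condition (c) is (b) for `T ∘ₗ negArg`.

Sufficiency of (a). If the zeros of `P` and `Q` interlace, then at each point of the upper
half-plane the sums of the arguments of their linear factors differ by an amount strictly between
consecutive multiples of π, unless all zeros agree. So no nontrivial real combination vanishes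
there.

Necessity. For fixed `n`, compare the moduli of `T[(z + w) ^ n]` and `T[(z + w̄) ^ n]` for `z`, `w`
in the upper half-plane. By connectedness either one of them always dominates strictly, which makes
one of the two symbols stable, or they agree somewhere. In the last case `T` kills a polynomial with
`n` alternating values, and perturbing it shows that `T` sends everything of degree at most `n` to a
hyperbolic polynomial or zero (`PreservesHyperbolicity.trichotomy`). The symbol conditions descend
from `n + 1` to `n`, so if (b) and (c) both fail, this happens for all large `n`. Evaluation at `i`
is then injective on the range, which bounds its dimension by two, and `zerosInterlace_of_pencil`
supplies the interlacing. -/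

namespace AlgHyp

/-! ### Polynomials without zeros in the upper half-plane -/

/-- A complex polynomial that does not vanish in the open upper half-plane. -/
def UpperNonvanishing (p : ℂ[X]) : Prop :=
  ∀ z : ℂ, 0 < z.im → p.eval z ≠ 0

lemma UpperNonvanishing.ne_zero {p : ℂ[X]} (hp : UpperNonvanishing p) : p ≠ 0 := by
  rintro rfl
  exact hp Complex.I (by simp) (by simp)

lemma UpperNonvanishing.im_le_of_mem_roots {p : ℂ[X]} (hp : UpperNonvanishing p) {r : ℂ}
    (hr : r ∈ p.roots) : r.im ≤ 0 := by
  by_contra! h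
  exact hp r h (isRoot_of_mem_roots hr)

/-- Every root is at distance at least `z₀.im` from `z₀`, which bounds each linear factor at `z` by
its value at `z₀`. This Harnack-type estimate makes Hurwitz's theorem elementary. -/
lemma UpperNonvanishing.norm_eval_le {p : ℂ[X]} (hp : UpperNonvanishing p) {z₀ : ℂ}
    (h₀ : 0 < z₀.im) (z : ℂ) :
    ‖p.eval z‖ ≤ ‖p.eval z₀‖ * (1 + ‖z - z₀‖ / z₀.im) ^ p.natDegree := by
  have hs := IsAlgClosed.splits p
  have key : ∀ s : Multiset ℂ, (∀ r ∈ s, r.im ≤ 0) →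
      ‖(s.map fun r => z - r).prod‖ ≤
        ‖(s.map fun r => z₀ - r).prod‖ * (1 + ‖z - z₀‖ / z₀.im) ^ s.card := by
    intro s
    induction s using Multiset.induction with
    | empty => simp
    | cons r s ih =>
      intro hr
      have h1 := ih fun x hx => hr x (Multiset.mem_cons_of_mem hx)
      have h2 : z₀.im ≤ ‖z₀ - r‖ := by
        have := Complex.abs_im_le_norm (z₀ - r)
        have h3 := hr r (Multiset.mem_cons_self r s)
        have h4 := le_abs_self (z₀ - r).im
        simp only [Complex.sub_im] at *
        linarith
      have h5 : ‖z - r‖ ≤ ‖z₀ - r‖ * (1 + ‖z - z₀‖ / z₀.im) := by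
        have h6 : ‖z - r‖ ≤ ‖z - z₀‖ + ‖z₀ - r‖ := by
          simpa using norm_add_le (z - z₀) (z₀ - r)
        have h7 : ‖z - z₀‖ ≤ ‖z₀ - r‖ * (‖z - z₀‖ / z₀.im) := by
          rw [mul_div_left_comm]
          exact le_mul_of_one_le_right (norm_nonneg _) ((one_le_div h₀).2 h2)
        linarith
      simp only [Multiset.map_cons, Multiset.prod_cons, norm_mul, Multiset.card_cons, pow_succ]
      calc _ ≤ _ := mul_le_mul h5 h1 (norm_nonneg _) (by positivity)
        _ = _ := by ring
  rw [hs.eval_eq_prod_roots, hs.eval_eq_prod_roots, norm_mul, norm_mul, hs.natDegree_eq_card_roots,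
    mul_assoc]
  exact mul_le_mul_of_nonneg_left (key _ fun r hr => hp.im_le_of_mem_roots hr) (norm_nonneg _)

/-- Hurwitz's theorem for polynomials of bounded degree in the upper half-plane. -/
lemma UpperNonvanishing.of_tendsto {ι : Type*} {l : Filter ι} [l.NeBot] {p : ι → ℂ[X]}
    {q : ℂ[X]} {N : ℕ} (hdeg : ∀ᶠ i in l, (p i).natDegree ≤ N)
    (hp : ∀ᶠ i in l, UpperNonvanishing (p i))
    (hlim : ∀ z : ℂ, Filter.Tendsto (fun i => (p i).eval z) l (nhds (q.eval z))) :
    UpperNonvanishing q ∨ q = 0 := by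
  by_contra! h
  obtain ⟨h1, h2⟩ := h
  simp only [UpperNonvanishing, not_forall, not_not] at h1
  obtain ⟨z₀, h₀, hz₀⟩ := h1
  refine h2 (Polynomial.funext fun z => ?_)
  -- The exponent is uniform, so the bound survives the limit: a zero of `q` at `z₀` forces `q` to
  -- vanish at every `z`.
  have hb : ∀ᶠ i in l, ‖(p i).eval z‖ ≤ ‖(p i).eval z₀‖ * (1 + ‖z - z₀‖ / z₀.im) ^ N := by
    filter_upwards [hdeg, hp] with i hi hi'
    refine (hi'.norm_eval_le h₀ z).trans ?_
    have : 0 ≤ ‖z - z₀‖ / z₀.im := by positivity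
    gcongr
    linarith
  have h3 := le_of_tendsto_of_tendsto (hlim z).norm ((hlim z₀).norm.mul_const _) hb
  rw [hz₀] at h3
  simpa using h3

/-- Gauss–Lucas: the closed lower half-plane is convex and contains the roots of `p`. -/
lemma UpperNonvanishing.derivative {p : ℂ[X]} (hp : UpperNonvanishing p) :
    UpperNonvanishing p.derivative ∨ p.derivative = 0 := by
  by_cases hd : p.derivative = 0
  · exact Or.inr hd
  refine Or.inl fun z hz h => ?_
  have hdeg : 0 < p.degree := by
    by_contra! h0
    exact hd (by rw [eq_C_of_degree_le_zero h0, derivative_C])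
  have h1 := rootSet_derivative_subset_convexHull_rootSet hdeg
    ((mem_rootSet (a := z)).2 ⟨hd, by simpa using h⟩)
  have h2 : p.rootSet ℂ ⊆ {w : ℂ | w.im ≤ 0} := by
    intro w hw
    by_contra! h3
    simp only [Set.mem_ofPred_eq, not_le] at h3
    exact hp w h3 (by simpa using (mem_rootSet.1 hw).2)
  have h3 := convexHull_min h2 (convex_halfSpace_im_le 0) h1
  simp only [Set.mem_ofPred_eq] at h3
  linarith

/-- Laguerre's theorem for the upper half-plane: polar derivatives do not vanish. -/
lemma UpperNonvanishing.polar_ne_zero {p : ℂ[X]} (hp : UpperNonvanishing p) {n : ℕ} (hn : 0 < n)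
    (hd : p.natDegree ≤ n) {w ζ : ℂ} (hw : 0 < w.im) (hζ : 0 < ζ.im) :
    n * p.eval w + (ζ - w) * p.derivative.eval w ≠ 0 := by
  intro h
  have hpw := hp w hw
  have hn' : (n : ℂ) ≠ 0 := by exact_mod_cast hn.ne'
  by_cases hwζ : w = ζ
  · subst hwζ
    simp only [sub_self, zero_mul, add_zero, mul_eq_zero] at h
    exact h.elim hn' hpw
  have hsub : w - ζ ≠ 0 := sub_ne_zero.2 hwζ
  set y : ℂ := (starRingEnd ℂ) w with hy
  have hs := IsAlgClosed.splits p
  have hsum := hs.eval_derivative_div_eval_of_ne_zero hpw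
  have hval : p.derivative.eval w / p.eval w = n / (w - ζ) := by
    rw [div_eq_div_iff hpw hsub]
    linear_combination (-1 : ℂ) * h
  rw [hval] at hsum
  -- With `y` the conjugate of `w`, the Möbius map `r ↦ 1 - (w - y) / (w - r) = (y - r) / (w - r)`
  -- sends the closed lower half-plane into the closed unit disc.
  have key : ∀ s : Multiset ℂ, (∀ r ∈ s, r.im ≤ 0) →
      ‖(s.card : ℂ) - (w - y) * (s.map fun r => 1 / (w - r)).sum‖ ≤ s.card := by
    intro s
    induction s using Multiset.induction with
    | empty => simp
    | cons r s ih =>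
      intro hr
      have h1 := ih fun x hx => hr x (Multiset.mem_cons_of_mem hx)
      have hr0 := hr r (Multiset.mem_cons_self r s)
      have hwr : w - r ≠ 0 := by
        intro h0
        have := congrArg Complex.im h0
        simp only [Complex.sub_im, Complex.zero_im] at this
        linarith
      have h2 : ‖1 - (w - y) * (1 / (w - r))‖ ≤ 1 := by
        have : 1 - (w - y) * (1 / (w - r)) = (y - r) / (w - r) := by
          field_simp
          ring
        rw [this, norm_div, div_le_one (norm_pos_iff.2 hwr)]
        rw [← sq_le_sq₀ (norm_nonneg _) (norm_nonneg _), Complex.sq_norm, Complex.sq_norm,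
          Complex.normSq_apply, Complex.normSq_apply]
        simp only [hy, Complex.sub_re, Complex.sub_im, Complex.conj_re, Complex.conj_im]
        nlinarith
      have h3 : ((r ::ₘ s).card : ℂ) - (w - y) * ((r ::ₘ s).map fun r => 1 / (w - r)).sum =
          ((s.card : ℂ) - (w - y) * (s.map fun r => 1 / (w - r)).sum) +
            (1 - (w - y) * (1 / (w - r))) := by
        simp only [Multiset.card_cons, Multiset.map_cons, Multiset.sum_cons]
        push_cast
        ring
      rw [h3]
      refine (norm_add_le _ _).trans ?_
      simp only [Multiset.card_cons]
      push_cast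
      linarith
  have h1 := key p.roots fun r hr => hp.im_le_of_mem_roots hr
  rw [← hsum] at h1
  have hcard : p.roots.card ≤ n := (card_roots' p).trans hd
  -- The `n - p.roots.card` missing roots count as roots at infinity, each contributing 1. So the
  -- image of `ζ` is an average of `n` points of the disc, although `ζ` lies in the upper half-plane
  -- and its image has modulus greater than 1.
  have h2 : (n : ℂ) * ((y - ζ) / (w - ζ)) =
      ((n - p.roots.card : ℕ) : ℂ) + ((p.roots.card : ℂ) - (w - y) * (n / (w - ζ))) := by
    rw [Nat.cast_sub hcard]
    field_simp
    ring
  have h3 : (n : ℝ) * ‖(y - ζ) / (w - ζ)‖ ≤ n := by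
    have h4 := norm_add_le ((n - p.roots.card : ℕ) : ℂ)
      ((p.roots.card : ℂ) - (w - y) * (n / (w - ζ)))
    rw [← h2, norm_mul, Complex.norm_natCast, Complex.norm_natCast, Nat.cast_sub hcard] at h4
    linarith
  have hn0 : (0 : ℝ) < n := by exact_mod_cast hn
  have h4 : ‖(y - ζ) / (w - ζ)‖ ≤ 1 := by
    by_contra! h5
    nlinarith
  rw [norm_div, div_le_one (norm_pos_iff.2 hsub), ← sq_le_sq₀ (norm_nonneg _) (norm_nonneg _),
    Complex.sq_norm, Complex.sq_norm, Complex.normSq_apply, Complex.normSq_apply] at h4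
  simp only [hy, Complex.sub_re, Complex.sub_im, Complex.conj_re, Complex.conj_im] at h4
  nlinarith [mul_pos hw hζ]

/-! ### Linear functionals and powers of linear polynomials -/

/-- The polynomial `w ↦ φ ((X + w) ^ n)`, see `eval_powPoly`. -/
noncomputable def powPoly (φ : ℂ[X] →ₗ[ℂ] ℂ) (n : ℕ) : ℂ[X] :=
  ∑ k ∈ Finset.range (n + 1), C (φ (X ^ k) * n.choose k) * X ^ (n - k)

lemma map_mul_C {M : Type*} [AddCommGroup M] [Module ℂ M] (φ : ℂ[X] →ₗ[ℂ] M) (p : ℂ[X]) (c : ℂ) :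
    φ (p * C c) = c • φ p := by
  rw [mul_comm, ← smul_eq_C_mul, map_smul]

lemma eval_powPoly (φ : ℂ[X] →ₗ[ℂ] ℂ) (n : ℕ) (w : ℂ) :
    (powPoly φ n).eval w = φ ((X + C w) ^ n) := by
  rw [powPoly, eval_finsetSum, add_pow, map_sum]
  refine Finset.sum_congr rfl fun k _ => ?_
  have : (X ^ k * C w ^ (n - k) * (n.choose k : ℂ[X]) : ℂ[X]) =
      X ^ k * C (w ^ (n - k) * n.choose k) := by
    simp [mul_assoc]
  rw [this, map_mul_C]
  simp
  ring

lemma natDegree_powPoly_le (φ : ℂ[X] →ₗ[ℂ] ℂ) (n : ℕ) : (powPoly φ n).natDegree ≤ n :=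
  natDegree_sum_le_of_forall_le _ _ fun k _ =>
    (natDegree_C_mul_X_pow_le _ _).trans (Nat.sub_le n k)

lemma derivative_powPoly (φ : ℂ[X] →ₗ[ℂ] ℂ) (n : ℕ) :
    derivative (powPoly φ (n + 1)) = C (n + 1 : ℂ) * powPoly φ n := by
  rw [powPoly, Finset.sum_range_succ, powPoly, derivative_add, derivative_sum, Finset.mul_sum]
  simp only [Nat.sub_self, pow_zero, mul_one, derivative_C, add_zero]
  refine Finset.sum_congr rfl fun k hk => ?_
  have hk' : k ≤ n := Nat.lt_succ_iff.1 (Finset.mem_range.1 hk)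
  have h1 : n + 1 - k = (n - k) + 1 := by omega
  have h2 : (n.choose k : ℂ) * (n + 1) = (n + 1).choose k * ((n - k : ℕ) + 1 : ℂ) := by
    have := Nat.choose_mul_succ_eq n k
    rw [h1] at this
    exact_mod_cast this
  rw [derivative_C_mul_X_pow, h1, Nat.add_sub_cancel, ← mul_assoc, ← C_mul]
  congr 2
  push_cast
  linear_combination (-φ (X ^ k)) * h2

/-- Taking the polar derivative with pole `ζ` amounts to replacing one factor `X + w` by `X + ζ`;
this is what links Laguerre's theorem to Grace's. -/
lemma polar_powPoly (φ : ℂ[X] →ₗ[ℂ] ℂ) (n : ℕ) (w ζ : ℂ) :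
    (n + 1 : ℂ) * φ ((X + C ζ) * (X + C w) ^ n) =
      ((n + 1 : ℕ) : ℂ) * (powPoly φ (n + 1)).eval w +
        (ζ - w) * (derivative (powPoly φ (n + 1))).eval w := by
  have h : (X + C ζ) * (X + C w) ^ n = (X + C w) ^ (n + 1) + (X + C w) ^ n * C (ζ - w) := by
    rw [C_sub]
    ring
  rw [h, map_add, map_mul_C, derivative_powPoly, eval_mul, eval_C, eval_powPoly, eval_powPoly]
  simp
  ring

lemma polar_functional_ne_zero {φ : ℂ[X] →ₗ[ℂ] ℂ} {n : ℕ}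
    (h : ∀ w : ℂ, 0 < w.im → φ ((X + C w) ^ (n + 1)) ≠ 0) {w ζ : ℂ} (hw : 0 < w.im)
    (hζ : 0 < ζ.im) : φ ((X + C ζ) * (X + C w) ^ n) ≠ 0 := by
  have hp : UpperNonvanishing (powPoly φ (n + 1)) := fun w hw => by
    rw [eval_powPoly]
    exact h w hw
  have h1 := hp.polar_ne_zero n.succ_pos (natDegree_powPoly_le φ (n + 1)) hw hζ
  rw [← polar_powPoly] at h1
  exact right_ne_zero_of_mul h1

/-- Grace's theorem for the upper half-plane, in terms of linear functionals. -/
lemma grace {n : ℕ} : ∀ {φ : ℂ[X] →ₗ[ℂ] ℂ},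
    (∀ w : ℂ, 0 < w.im → φ ((X + C w) ^ n) ≠ 0) → ∀ s : List ℂ, s.length = n →
      (∀ w ∈ s, 0 < w.im) → φ (s.map fun w => X + C w).prod ≠ 0 := by
  induction n with
  | zero =>
    intro φ h s hs _
    rw [List.length_eq_zero_iff.1 hs]
    simpa using h Complex.I (by simp)
  | succ n ih =>
    intro φ h s hs hw
    obtain ⟨ζ, t, rfl⟩ := List.exists_cons_of_length_eq_add_one hs
    -- The factor `X + ζ` is absorbed into the functional, which is why the induction is over all
    -- `φ`.
    have := ih (φ := φ ∘ₗ LinearMap.mulLeft ℂ (X + C ζ))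
      (fun w hw' => by
        simpa using polar_functional_ne_zero h hw' (hw ζ List.mem_cons_self)) t
      (by simpa using hs) fun w hw' => hw w (List.mem_cons_of_mem _ hw')
    simpa using this

lemma continuous_functional_prod (s : List ℂ) : ∀ φ : ℂ[X] →ₗ[ℂ] ℂ,
    Continuous fun u : ℂ => φ (s.map fun w => X + C (w + u)).prod := by
  induction s with
  | nil => intro φ; simpa using continuous_const
  | cons a s ih =>
    intro φ
    have h : ∀ u : ℂ, φ ((a :: s).map fun w => X + C (w + u)).prod =
        (φ ∘ₗ LinearMap.mulLeft ℂ X) (s.map fun w => X + C (w + u)).prod +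
          (a + u) * φ (s.map fun w => X + C (w + u)).prod := by
      intro u
      rw [List.map_cons, List.prod_cons, add_mul, map_add, mul_comm (C (a + u)), map_mul_C]
      simp
    simp only [h]
    exact (ih _).add ((continuous_const.add continuous_id).mul (ih φ))

end AlgHyp

namespace AlgHyp

/-! ### Hyperbolic polynomials -/

lemma eval_map_algebraMap_complex (f : ℝ[X]) (z : ℂ) :
    (f.map (algebraMap ℝ ℂ)).eval z = aeval z f := by
  rw [aeval_def, eval_map]

lemma Hyperbolic.upperNonvanishing {f : ℝ[X]} (hf : Hyperbolic f) :
    UpperNonvanishing (f.map (algebraMap ℝ ℂ)) := fun z hz h => by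
  rw [eval_map_algebraMap_complex] at h
  exact hz.ne' (hf.2 z h)

lemma UpperNonvanishing.hyperbolic {f : ℝ[X]}
    (hf : UpperNonvanishing (f.map (algebraMap ℝ ℂ))) : Hyperbolic f := by
  refine ⟨?_, fun z hz => ?_⟩
  · rintro rfl
    exact hf.ne_zero (by simp)
  · rcases lt_trichotomy z.im 0 with h | h | h
    · have h1 : aeval ((starRingEnd ℂ) z) f = 0 := by rw [aeval_conj, hz, map_zero]
      exact absurd (by rwa [eval_map_algebraMap_complex]) (hf ((starRingEnd ℂ) z) (by simpa))
    · exact h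
    · exact absurd (by rwa [eval_map_algebraMap_complex]) (hf z h)

lemma Hyperbolic.smul {f : ℝ[X]} (hf : Hyperbolic f) {c : ℝ} (hc : c ≠ 0) :
    Hyperbolic (c • f) := by
  refine ⟨smul_ne_zero hc hf.1, fun z hz => hf.2 z ?_⟩
  rw [map_smul] at hz
  exact (smul_eq_zero.1 hz).resolve_left hc

/-- Composition with `-X`. -/
noncomputable def negArg : ℝ[X] →ₗ[ℝ] ℝ[X] :=
  (aeval (-X : ℝ[X])).toLinearMap

lemma aeval_negArg (f : ℝ[X]) (z : ℂ) : aeval z (negArg f) = aeval (-z) f := by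
  simp [negArg, ← aeval_algHom_apply]

lemma negArg_negArg (f : ℝ[X]) : negArg (negArg f) = f := by
  simp only [negArg, AlgHom.toLinearMap_apply, ← aeval_algHom_apply]
  simp

lemma Hyperbolic.negArg {f : ℝ[X]} (hf : Hyperbolic f) : Hyperbolic (negArg f) := by
  refine ⟨fun h => hf.1 ?_, fun z hz => ?_⟩
  · rw [← negArg_negArg f, h, map_zero]
  · rw [aeval_negArg] at hz
    simpa using hf.2 _ hz

lemma preservesHyperbolicity_of_negArg {T : ℝ[X] →ₗ[ℝ] ℝ[X]}
    (h : PreservesHyperbolicity (T ∘ₗ negArg)) : PreservesHyperbolicity T := fun f hf => by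
  simpa [negArg_negArg] using h _ hf.negArg

/-! ### Complexification of an operator -/

/-- The complex-linear extension of a real operator on polynomials. -/
noncomputable def complexify (T : ℝ[X] →ₗ[ℝ] ℝ[X]) : ℂ[X] →ₗ[ℂ] ℂ[X] :=
  (basisMonomials ℂ).constr ℂ fun k => (T (X ^ k)).map (algebraMap ℝ ℂ)

lemma complexify_X_pow (T : ℝ[X] →ₗ[ℝ] ℝ[X]) (k : ℕ) :
    complexify T (X ^ k) = (T (X ^ k)).map (algebraMap ℝ ℂ) := by
  have : (X ^ k : ℂ[X]) = basisMonomials ℂ k := by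
    simp [monomial_one_right_eq_X_pow]
  rw [this, complexify, Module.Basis.constr_basis]

lemma complexify_map (T : ℝ[X] →ₗ[ℝ] ℝ[X]) (f : ℝ[X]) :
    complexify T (f.map (algebraMap ℝ ℂ)) = (T f).map (algebraMap ℝ ℂ) := by
  induction f using Polynomial.induction_on' with
  | add p q hp hq => rw [Polynomial.map_add, map_add, hp, hq, map_add, Polynomial.map_add]
  | monomial n a =>
    rw [← C_mul_X_pow_eq_monomial, Polynomial.map_mul, Polynomial.map_C, Polynomial.map_pow,
      Polynomial.map_X, ← smul_eq_C_mul, map_smul, complexify_X_pow, ← smul_eq_C_mul, map_smul,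
      smul_eq_C_mul, smul_eq_C_mul, Polynomial.map_mul, Polynomial.map_C]

lemma complexify_negArg (T : ℝ[X] →ₗ[ℝ] ℝ[X]) (w : ℂ) (n : ℕ) :
    complexify (T ∘ₗ negArg) ((X + C w) ^ n) = (-1 : ℂ) ^ n • complexify T ((X - C w) ^ n) := by
  have h : complexify (T ∘ₗ negArg) = complexify T ∘ₗ (aeval (-X : ℂ[X])).toLinearMap := by
    refine (basisMonomials ℂ).ext fun k => ?_
    have h1 : negArg (X ^ k) = (-1 : ℝ) ^ k • X ^ k := by
      simp only [negArg, AlgHom.toLinearMap_apply, map_pow, aeval_X]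
      rw [neg_pow, smul_eq_C_mul]
      simp
    have h2 : (aeval (-X : ℂ[X])) (X ^ k : ℂ[X]) = (-1 : ℂ) ^ k • X ^ k := by
      simp only [map_pow, aeval_X]
      rw [neg_pow, smul_eq_C_mul]
      simp
    simp only [coe_basisMonomials, monomial_one_right_eq_X_pow, LinearMap.comp_apply,
      AlgHom.toLinearMap_apply]
    rw [complexify_X_pow, h2, LinearMap.comp_apply, h1, map_smul, map_smul, complexify_X_pow,
      smul_eq_C_mul, smul_eq_C_mul, Polynomial.map_mul]
    simp
  rw [h, LinearMap.comp_apply, AlgHom.toLinearMap_apply]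
  have h3 : aeval (-X : ℂ[X]) ((X + C w) ^ n) = (-1 : ℂ) ^ n • (X - C w) ^ n := by
    rw [map_pow, map_add, aeval_X, aeval_C, smul_eq_C_mul, map_pow, ← mul_pow]
    congr 1
    simp
    ring
  rw [h3, map_smul]

/-- The functional `f ↦ (A f)(z)`. -/
noncomputable def evalComp (A : ℂ[X] →ₗ[ℂ] ℂ[X]) (z : ℂ) : ℂ[X] →ₗ[ℂ] ℂ :=
  leval z ∘ₗ A

@[simp] lemma evalComp_apply (A : ℂ[X] →ₗ[ℂ] ℂ[X]) (z : ℂ) (p : ℂ[X]) :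
    evalComp A z p = (A p).eval z := rfl

/-- Supplies the uniform degree bound that `UpperNonvanishing.of_tendsto` requires. -/
lemma exists_natDegree_map_le (A : ℂ[X] →ₗ[ℂ] ℂ[X]) (n : ℕ) :
    ∃ N, ∀ p : ℂ[X], p.natDegree ≤ n → (A p).natDegree ≤ N := by
  refine ⟨(Finset.range (n + 1)).sup fun k => (A (X ^ k)).natDegree, fun p hp => ?_⟩
  rw [as_sum_range' p (n + 1) (Nat.lt_succ_iff.2 hp), map_sum]
  refine natDegree_sum_le_of_forall_le _ _ fun k hk => ?_
  rw [← C_mul_X_pow_eq_monomial, ← smul_eq_C_mul, map_smul]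
  exact (natDegree_smul_le _ _).trans
    (Finset.le_sup (f := fun k => (A (X ^ k)).natDegree) hk)

/-! ### The symbol of an operator -/

/-- The symbol `A[(z + w) ^ n]` does not vanish for `z`, `w` in the upper half-plane. -/
def SymbolStable (A : ℂ[X] →ₗ[ℂ] ℂ[X]) (n : ℕ) : Prop :=
  ∀ z w : ℂ, 0 < z.im → 0 < w.im → (A ((X + C w) ^ n)).eval z ≠ 0

/-- The symbol `A[(z + w) ^ n]` is identically zero. -/
def SymbolZero (A : ℂ[X] →ₗ[ℂ] ℂ[X]) (n : ℕ) : Prop :=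
  ∀ w : ℂ, A ((X + C w) ^ n) = 0

lemma aeval_extend_pow (T : ℝ[X] →ₗ[ℝ] ℝ[X]) (c : ℝ) (n : ℕ) (v : Fin 2 → ℂ) :
    MvPolynomial.aeval v (extend T ((MvPolynomial.X 0 + c • MvPolynomial.X 1) ^ n)) =
      (complexify T ((X + C (c * v 1)) ^ n)).eval (v 0) := by
  rw [add_pow, add_pow, map_sum, map_sum, map_sum, eval_finsetSum]
  refine Finset.sum_congr rfl fun k _ => ?_
  have h1 : (MvPolynomial.X 0 ^ k * (c • MvPolynomial.X 1) ^ (n - k) *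
      (n.choose k : MvPolynomial (Fin 2) ℝ) : MvPolynomial (Fin 2) ℝ) = (c ^ (n - k) * n.choose k) •
        (MvPolynomial.X 0 ^ k * MvPolynomial.X 1 ^ (n - k)) := by
    simp only [MvPolynomial.smul_eq_C_mul, mul_pow, map_mul, map_pow, map_natCast]
    ring
  have h2 : (X ^ k * C (c * v 1 : ℂ) ^ (n - k) * (n.choose k : ℂ[X]) : ℂ[X]) =
      X ^ k * C ((c * v 1) ^ (n - k) * n.choose k) := by
    simp [mul_assoc]
  rw [h1, h2, map_smul, extend_monomial, map_mul_C, complexify_X_pow, map_smul, map_mul,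
    ← aeval_algHom_apply, eval_smul, eval_map_algebraMap_complex]
  simp [Complex.real_smul, mul_pow]
  ring

lemma eq_zero_of_forall_upper {p : ℂ[X]} (h : ∀ z : ℂ, 0 < z.im → p.eval z = 0) : p = 0 := by
  refine eq_zero_of_infinite_isRoot p ?_
  refine Set.Infinite.mono (s := Set.range fun x : ℝ => (x : ℂ) + Complex.I) ?_
    (Set.infinite_range_of_injective fun x y hxy => by simpa using hxy)
  rintro _ ⟨x, rfl⟩
  exact h _ (by simp)

lemma mvPolynomial_eq_zero {q : MvPolynomial (Fin 2) ℝ}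
    (h : ∀ v : Fin 2 → ℂ, MvPolynomial.aeval v q = 0) : q = 0 := by
  refine MvPolynomial.map_injective (algebraMap ℝ ℂ) (algebraMap ℝ ℂ).injective ?_
  rw [map_zero]
  refine MvPolynomial.funext fun v => ?_
  rw [MvPolynomial.eval_map, map_zero]
  exact h v

lemma realStable_add_iff (T : ℝ[X] →ₗ[ℝ] ℝ[X]) (n : ℕ) :
    (RealStable (extend T ((MvPolynomial.X 0 + MvPolynomial.X 1) ^ n)) ∨
      extend T ((MvPolynomial.X 0 + MvPolynomial.X 1) ^ n) = 0) ↔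
    (SymbolStable (complexify T) n ∨ SymbolZero (complexify T) n) := by
  have h : ∀ v : Fin 2 → ℂ,
      MvPolynomial.aeval v (extend T ((MvPolynomial.X 0 + MvPolynomial.X 1) ^ n)) =
        (complexify T ((X + C (v 1)) ^ n)).eval (v 0) := fun v => by
    simpa using aeval_extend_pow T 1 n v
  refine or_congr ⟨fun hs z w hz hw => ?_, fun hs v hv => ?_⟩ ⟨fun h0 w => ?_, fun h0 => ?_⟩
  · have := hs ![z, w] (by simp [Fin.forall_fin_two, hz, hw])
    rw [h] at this
    simpa using this
  · rw [h]
    exact hs _ _ (hv 0) (hv 1)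
  · refine Polynomial.funext fun z => ?_
    have := h ![z, w]
    rw [h0, map_zero] at this
    simpa using this.symm
  · refine mvPolynomial_eq_zero fun v => ?_
    rw [h, h0, eval_zero]

lemma realStable_sub_iff (T : ℝ[X] →ₗ[ℝ] ℝ[X]) (n : ℕ) :
    (RealStable (extend T ((MvPolynomial.X 0 - MvPolynomial.X 1) ^ n)) ∨
      extend T ((MvPolynomial.X 0 - MvPolynomial.X 1) ^ n) = 0) ↔
    (SymbolStable (complexify (T ∘ₗ negArg)) n ∨ SymbolZero (complexify (T ∘ₗ negArg)) n) := by
  have h : ∀ v : Fin 2 → ℂ,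
      MvPolynomial.aeval v (extend T ((MvPolynomial.X 0 - MvPolynomial.X 1) ^ n)) =
        (-1) ^ n * (complexify (T ∘ₗ negArg) ((X + C (v 1)) ^ n)).eval (v 0) := fun v => by
    have h1 := aeval_extend_pow T (-1) n v
    rw [complexify_negArg, eval_smul, smul_eq_mul, ← mul_assoc, ← mul_pow]
    simpa [← sub_eq_add_neg] using h1
  have hne : (-1 : ℂ) ^ n ≠ 0 := by simp
  refine or_congr ⟨fun hs z w hz hw => ?_, fun hs v hv => ?_⟩ ⟨fun h0 w => ?_, fun h0 => ?_⟩
  · have := hs ![z, w] (by simp [Fin.forall_fin_two, hz, hw])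
    rw [h] at this
    simpa using this
  · rw [h]
    exact mul_ne_zero hne (hs _ _ (hv 0) (hv 1))
  · refine Polynomial.funext fun z => ?_
    have := h ![z, w]
    rw [h0, map_zero] at this
    simpa using this.symm
  · refine mvPolynomial_eq_zero fun v => ?_
    rw [h, h0, eval_zero, mul_zero]

/-! ### Sufficiency of the symbol conditions, and their descent in the degree -/

lemma functional_prod_eq_zero {n : ℕ} : ∀ {φ : ℂ[X] →ₗ[ℂ] ℂ},
    (∀ w : ℂ, φ ((X + C w) ^ n) = 0) → ∀ s : List ℂ, s.length = n →
      φ (s.map fun w => X + C w).prod = 0 := by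
  induction n with
  | zero =>
    intro φ h s hs
    rw [List.length_eq_zero_iff.1 hs]
    simpa using h 0
  | succ n ih =>
    intro φ h s hs
    obtain ⟨ζ, t, rfl⟩ := List.exists_cons_of_length_eq_add_one hs
    have h0 : powPoly φ (n + 1) = 0 := Polynomial.funext fun w => by
      rw [eval_powPoly, h, eval_zero]
    have hn : (n + 1 : ℂ) ≠ 0 := by exact_mod_cast n.succ_ne_zero
    have := ih (φ := φ ∘ₗ LinearMap.mulLeft ℂ (X + C ζ))
      (fun w => by
        have h1 := polar_powPoly φ n w ζ
        rw [h0] at h1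
        simpa [hn] using h1) t (by simpa using hs)
    simpa using this

theorem preservesHyperbolicity_of_symbol {T : ℝ[X] →ₗ[ℝ] ℝ[X]}
    (h : ∀ n, SymbolStable (complexify T) n ∨ SymbolZero (complexify T) n) :
    PreservesHyperbolicity T := by
  intro f hf
  set F : ℂ[X] := f.map (algebraMap ℝ ℂ) with hF
  set s : List ℂ := (F.roots.map fun r => -r).toList with hs
  have hs_im : ∀ w ∈ s, w.im = 0 := by
    intro w hw
    rw [hs, Multiset.mem_toList, Multiset.mem_map] at hw
    obtain ⟨r, hr, rfl⟩ := hw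
    have h1 : F.eval r = 0 := isRoot_of_mem_roots hr
    rw [hF, eval_map_algebraMap_complex] at h1
    simpa using hf.2 r h1
  have hprod : F = C F.leadingCoeff * (s.map fun w => X + C w).prod := by
    conv_lhs => rw [(IsAlgClosed.splits F).eq_prod_roots]
    congr 1
    rw [← Multiset.prod_coe, ← Multiset.map_coe, hs, Multiset.coe_toList, Multiset.map_map]
    simp [sub_eq_add_neg]
  set G : ℂ[X] := (s.map fun w => X + C w).prod with hG
  have hlc : F.leadingCoeff ≠ 0 := by
    rw [leadingCoeff_ne_zero]
    exact hf.upperNonvanishing.ne_zero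
  have hTF : (T f).map (algebraMap ℝ ℂ) = C F.leadingCoeff * complexify T G := by
    rw [← complexify_map, ← hF]
    conv_lhs => rw [hprod]
    rw [← smul_eq_C_mul, map_smul, smul_eq_C_mul]
  suffices hsuff : UpperNonvanishing (complexify T G) ∨ complexify T G = 0 by
    rcases hsuff with h1 | h1
    · refine Or.inl (UpperNonvanishing.hyperbolic fun z hz => ?_)
      rw [hTF, eval_mul, eval_C]
      exact mul_ne_zero hlc (h1 z hz)
    · right
      rw [h1, mul_zero] at hTF
      exact (Polynomial.map_eq_zero _).1 hTF
  rcases h s.length with hst | hz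
  -- The negated roots in `s` are real, on the boundary of the region where `grace` applies; moving
  -- them up by `ε` enters it, and `ε → 0⁺` recovers `G`.
  · set p : ℝ → ℂ[X] := fun ε => complexify T (s.map fun w => X + C (w + ε * Complex.I)).prod
      with hp
    obtain ⟨N, hN⟩ := exists_natDegree_map_le (complexify T) s.length
    refine UpperNonvanishing.of_tendsto (l := nhdsWithin 0 (Set.Ioi 0)) (p := p) (N := N)
      (Filter.Eventually.of_forall fun ε => hN _ ?_) ?_ fun z => ?_
    · refine (natDegree_list_prod_le _).trans ?_
      rw [List.map_map]
      refine (List.sum_le_card_nsmul _ 1 fun x hx => ?_).trans (by simp)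
      obtain ⟨w, _, rfl⟩ := List.mem_map.1 hx
      simp only [Function.comp_apply]
      exact (natDegree_X_add_C _).le
    · filter_upwards [self_mem_nhdsWithin] with ε hε z hz
      have := grace (φ := evalComp (complexify T) z) (n := s.length)
        (fun w hw => hst z w hz hw) (s.map fun w => w + ε * Complex.I) (by simp) (by
          intro w hw
          obtain ⟨u, hu, rfl⟩ := List.mem_map.1 hw
          simpa [hs_im u hu] using hε)
      simpa only [List.map_map, Function.comp_def, evalComp_apply] using this
    · have hc := continuous_functional_prod s (evalComp (complexify T) z)
      have hc' : Continuous fun ε : ℝ => (p ε).eval z :=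
        hc.comp (Complex.continuous_ofReal.mul continuous_const)
      have := hc'.tendsto 0
      simp only [hp, Complex.ofReal_zero, zero_mul, add_zero] at this
      exact this.mono_left nhdsWithin_le_nhds
  · refine Or.inr (Polynomial.funext fun z => ?_)
    rw [eval_zero]
    exact functional_prod_eq_zero (φ := evalComp (complexify T) z)
      (fun w => by rw [evalComp_apply, hz, eval_zero]) s rfl

/-- Up to a constant, the symbol of order `n` is the `w`-derivative of the one of order `n + 1`.
Gauss–Lucas in `w` alone could leave it zero for some `z` and nonzero for others; the limit in `z`
below excludes this. -/
lemma symbol_of_symbol_succ {A : ℂ[X] →ₗ[ℂ] ℂ[X]} {n : ℕ}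
    (h : SymbolStable A (n + 1) ∨ SymbolZero A (n + 1)) : SymbolStable A n ∨ SymbolZero A n := by
  have hn : (n + 1 : ℂ) ≠ 0 := by exact_mod_cast n.succ_ne_zero
  rcases h with hst | hz
  · by_contra! hcon
    obtain ⟨h1, h2⟩ := hcon
    simp only [SymbolStable, not_forall, not_not] at h1
    obtain ⟨z₀, w₀, hz₀, hw₀, h0⟩ := h1
    -- Send one factor `X + ζ` to infinity along `ζ = t * I`: after division by `ζ` the images,
    -- nonvanishing in `z`, tend to `A ((X + w₀) ^ n)`. Hurwitz turns its zero at `z₀` into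
    -- identical vanishing.
    have hA : A ((X + C w₀) ^ n) = 0 := by
      obtain ⟨N, hN⟩ := exists_natDegree_map_le A (n + 1)
      have hlim := UpperNonvanishing.of_tendsto (l := Filter.atTop) (N := N)
        (p := fun t : ℝ => C (1 / (t * Complex.I)) * A ((X + C (t * Complex.I)) * (X + C w₀) ^ n))
        (q := A ((X + C w₀) ^ n))
        (Filter.Eventually.of_forall fun t => (natDegree_C_mul_le _ _).trans (hN _ ?_)) ?_
        fun z => ?_
      · exact hlim.resolve_left fun hu => hu z₀ hz₀ h0
      · refine natDegree_mul_le.trans ?_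
        rw [natDegree_X_add_C, natDegree_pow, natDegree_X_add_C]
        omega
      · filter_upwards [Filter.eventually_gt_atTop 0] with t ht z hz
        rw [eval_mul, eval_C]
        refine mul_ne_zero (by simp [ht.ne']) ?_
        exact polar_functional_ne_zero (φ := evalComp A z) (fun w hw => hst z w hz hw) hw₀
          (by simpa using ht)
      · have heq : ∀ᶠ t : ℝ in Filter.atTop,
            ((t : ℂ)⁻¹ * (Complex.I⁻¹ * (A (X * (X + C w₀) ^ n)).eval z)) +
              (A ((X + C w₀) ^ n)).eval z =
            (C (1 / (t * Complex.I)) *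
              A ((X + C (t * Complex.I)) * (X + C w₀) ^ n)).eval z := by
          filter_upwards [Filter.eventually_gt_atTop 0] with t ht
          have ht' : (t : ℂ) ≠ 0 := by exact_mod_cast ht.ne'
          rw [add_mul, map_add, mul_comm (C (t * Complex.I)), map_mul_C, eval_mul, eval_C,
            eval_add, eval_smul, smul_eq_mul]
          field_simp [Complex.I_ne_zero]
        refine Filter.Tendsto.congr' heq ?_
        have h3 : Filter.Tendsto (fun t : ℝ => ((t : ℂ))⁻¹) Filter.atTop (nhds 0) := by
          have := (Complex.continuous_ofReal.tendsto 0).comp tendsto_inv_atTop_zero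
          simpa [Function.comp_def] using this
        simpa only [zero_mul, zero_add] using
          (h3.mul_const (Complex.I⁻¹ * (A (X * (X + C w₀) ^ n)).eval z)).add_const
            ((A ((X + C w₀) ^ n)).eval z)
    refine h2 fun w => eq_zero_of_forall_upper fun z hz => ?_
    have hp : UpperNonvanishing (powPoly (evalComp A z) (n + 1)) := fun w hw => by
      rw [eval_powPoly]
      exact hst z w hz hw
    have hd := hp.derivative
    rw [derivative_powPoly] at hd
    have h4 := hd.resolve_left fun hu => hu w₀ hw₀ (by
      rw [eval_mul, eval_powPoly, evalComp_apply, hA, eval_zero, mul_zero])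
    have h5 := congrArg (eval w) h4
    rw [eval_mul, eval_powPoly, eval_C, eval_zero] at h5
    exact (mul_eq_zero.1 h5).resolve_left hn
  · refine Or.inr fun w => Polynomial.funext fun z => ?_
    have h0 : powPoly (evalComp A z) (n + 1) = 0 := Polynomial.funext fun w => by
      rw [eval_powPoly, evalComp_apply, hz]
      simp
    have h1 := derivative_powPoly (evalComp A z) n
    rw [h0, derivative_zero] at h1
    have h5 := congrArg (eval w) h1.symm
    rw [eval_mul, eval_powPoly, eval_C, eval_zero] at h5
    simpa using (mul_eq_zero.1 h5).resolve_left hn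

lemma symbol_of_le {A : ℂ[X] →ₗ[ℂ] ℂ[X]} {m n : ℕ} (hmn : m ≤ n)
    (h : SymbolStable A n ∨ SymbolZero A n) : SymbolStable A m ∨ SymbolZero A m := by
  induction n, hmn using Nat.le_induction with
  | base => exact h
  | succ n _ ih => exact ih (symbol_of_symbol_succ h)

end AlgHyp

namespace AlgHyp

/-! ### Sign changes -/

/-- One missing root is harmless: the cofactor without real roots has degree at most one, hence is
constant. -/
lemma hyperbolic_of_card_roots {p : ℝ[X]} (hp : p ≠ 0) (h : p.natDegree ≤ p.roots.card + 1) :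
    Hyperbolic p := by
  obtain ⟨q, hq, hcard, hroots⟩ := exists_prod_multiset_X_sub_C_mul p
  have hq0 : q ≠ 0 := by
    rintro rfl
    exact hp (by rw [← hq, mul_zero])
  have hdeg : q.natDegree = 0 := by
    by_contra hne
    have h1 : q.natDegree = 1 := by omega
    obtain ⟨x, hx⟩ := exists_root_of_degree_eq_one ((degree_eq_iff_natDegree_eq hq0).2 h1)
    have := (mem_roots hq0).2 hx
    simp [hroots] at this
  refine ⟨hp, fun z hz => ?_⟩
  rw [eq_C_of_natDegree_eq_zero hdeg] at hq hq0
  rw [← hq, map_mul, aeval_C] at hz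
  have h2 : algebraMap ℝ ℂ (q.coeff 0) ≠ 0 := by
    simpa using hq0
  have h3 := (mul_eq_zero.1 hz).resolve_right h2
  rw [map_multiset_prod, Multiset.prod_eq_zero_iff, Multiset.map_map, Multiset.mem_map] at h3
  obtain ⟨a, _, ha⟩ := h3
  simp only [Function.comp_apply, map_sub, aeval_X, aeval_C, sub_eq_zero] at ha
  rw [ha]
  simp

/-- The values of `g` at `x 0, …, x (n - 1)` alternate in sign, starting with
a positive value. -/
def AlternatingValues (g : ℝ → ℝ) (x : ℕ → ℝ) (n : ℕ) : Prop :=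
  ∀ k < n, 0 < (-1) ^ k * g (x k)

/-- The `n` sign-alternating values give `n - 1` distinct real zeros, one short of the degree bound.
The hypothesis is open in `p`, so it survives small perturbations. -/
lemma hyperbolic_of_alternatingValues {p : ℝ[X]} {n : ℕ} (hn : 0 < n) (hd : p.natDegree ≤ n)
    {x : ℕ → ℝ} (hx : ∀ j k, j < k → k < n → x k < x j)
    (h : AlternatingValues (fun t => p.eval t) x n) : Hyperbolic p := by
  have hp : p ≠ 0 := by
    rintro rfl
    simpa using h 0 hn
  refine hyperbolic_of_card_roots hp (hd.trans ?_)
  have hroot : ∀ k, ∃ r, k + 1 < n → x (k + 1) < r ∧ r < x k ∧ p.eval r = 0 := by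
    intro k
    by_cases hk : k + 1 < n
    · have h1 := h k (by omega)
      have h2 := h (k + 1) hk
      have hlt := hx k (k + 1) (by omega) hk
      rw [pow_succ] at h2
      have hc : ContinuousOn (fun t => (-1) ^ k * p.eval t) (Set.Icc (x (k + 1)) (x k)) :=
        (continuous_const.mul p.continuous).continuousOn
      obtain ⟨r, hr, hr0⟩ := intermediate_value_Ioo hlt.le hc
        (show (0 : ℝ) ∈ _ from ⟨by linarith, h1⟩)
      refine ⟨r, fun _ => ⟨hr.1, hr.2, ?_⟩⟩
      simpa using hr0
    · exact ⟨0, fun h => absurd h hk⟩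
  choose r hr using hroot
  have hanti : ∀ j k, j < k → k + 1 < n → r k < r j := by
    intro j k hjk hk
    have h1 := (hr k hk).2.1
    have h2 := (hr j (by omega)).1
    rcases Nat.lt_or_ge (j + 1) k with h3 | h3
    · linarith [hx (j + 1) k h3 (by omega)]
    · obtain rfl : k = j + 1 := by omega
      linarith
  have hsub : (Finset.range (n - 1)).image r ⊆ p.roots.toFinset := by
    intro t ht
    obtain ⟨k, hk, rfl⟩ := Finset.mem_image.1 ht
    rw [Finset.mem_range] at hk
    rw [Multiset.mem_toFinset, mem_roots hp]
    exact (hr k (by omega)).2.2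
  have hcard : ((Finset.range (n - 1)).image r).card = n - 1 := by
    rw [Finset.card_image_of_injOn, Finset.card_range]
    intro j hj k hk hjk
    simp only [Finset.coe_range, Set.mem_Iio] at hj hk
    rcases lt_trichotomy j k with h1 | h1 | h1
    · exact absurd hjk (hanti j k h1 (by omega)).ne'
    · exact h1
    · exact absurd hjk (hanti k j h1 (by omega)).ne
  have := (Finset.card_le_card hsub).trans (Multiset.toFinset_card_le _)
  omega

/-- For `t = w.im * cot θ - w.re` the number `t + w` has argument `θ`, so `c * (t + w) ^ n` has
argument `c.arg + n * θ`. As `θ` runs through `(0, π)`, its real part changes sign often enough. -/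
lemma exists_alternatingValues_of_arg {w c : ℂ} (hw : 0 < w.im) (hc : c ≠ 0) (h0 : 0 ≤ c.arg)
    (hπ : c.arg < Real.pi) {n : ℕ} (hn : 0 < n) :
    ∃ x : ℕ → ℝ, (∀ j k, j < k → k < n → x k < x j) ∧
      AlternatingValues (fun t => -(c * (t + w) ^ n).re) x n := by
  obtain ⟨η, hη0, hη1, hη2⟩ : ∃ η : ℝ, 0 < η ∧ η < Real.pi / 2 ∧ c.arg + η < Real.pi :=
    ⟨(Real.pi - c.arg) / 4, by linarith, by linarith, by linarith⟩
  have hn' : (0 : ℝ) < n := by exact_mod_cast hn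
  -- Chosen so that the argument becomes `(k + 1)π - η`. The offset `η > 0` keeps the last angle
  -- below π even when `c.arg = 0`, and `η < π / 2` keeps the cosine nonzero.
  set θ : ℕ → ℝ := fun k => ((k + 1) * Real.pi - c.arg - η) / n with hθ
  have hθn : ∀ k, n * θ k = (k + 1) * Real.pi - c.arg - η := fun k => by
    simp only [hθ]
    field_simp
  have hpi := Real.pi_pos
  have hθ0 : ∀ k, 0 < θ k := fun k => by
    refine div_pos ?_ hn'
    nlinarith [(Nat.cast_nonneg k : (0 : ℝ) ≤ k)]
  have hθπ : ∀ k, k < n → θ k < Real.pi := fun k hk => by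
    have hk' : (k : ℝ) + 1 ≤ n := by exact_mod_cast hk
    rw [div_lt_iff₀ hn']
    nlinarith
  have hθmono : ∀ j k, j < k → θ j < θ k := fun j k hjk => by
    have : (j : ℝ) < k := by exact_mod_cast hjk
    refine div_lt_div_of_pos_right ?_ hn'
    nlinarith
  have hsin : ∀ k, k < n → 0 < Real.sin (θ k) := fun k hk =>
    Real.sin_pos_of_pos_of_lt_pi (hθ0 k) (hθπ k hk)
  refine ⟨fun k => w.im * (Real.cos (θ k) / Real.sin (θ k)) - w.re, fun j k hjk hk => ?_,
    fun k hk => ?_⟩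
  · have h1 : 0 < Real.sin (θ k - θ j) := Real.sin_pos_of_pos_of_lt_pi
      (sub_pos.2 (hθmono j k hjk)) (by linarith [hθπ k hk, hθ0 j])
    rw [Real.sin_sub] at h1
    have h2 : Real.cos (θ k) / Real.sin (θ k) < Real.cos (θ j) / Real.sin (θ j) := by
      rw [div_lt_div_iff₀ (hsin k hk) (hsin j (by omega))]
      linarith
    simp only
    nlinarith
  · have hs := hsin k hk
    have hs' : (Real.sin (θ k) : ℂ) ≠ 0 := by exact_mod_cast hs.ne'
    have h1 : ((w.im * (Real.cos (θ k) / Real.sin (θ k)) - w.re : ℝ) : ℂ) + w =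
        ((w.im / Real.sin (θ k) : ℝ) : ℂ) * Complex.exp (θ k * Complex.I) := by
      rw [Complex.exp_mul_I, ← Complex.ofReal_cos, ← Complex.ofReal_sin]
      push_cast at hs' ⊢
      field_simp
      linear_combination -Complex.sin (θ k) * Complex.re_add_im w
    have h2 : c * (((w.im * (Real.cos (θ k) / Real.sin (θ k)) - w.re : ℝ) : ℂ) + w) ^ n =
        ((‖c‖ * (w.im / Real.sin (θ k)) ^ n : ℝ) : ℂ) *
          Complex.exp ((((k : ℝ) + 1) * Real.pi - η : ℝ) * Complex.I) := by
      have h3 : ((((k : ℝ) + 1) * Real.pi - η : ℝ) : ℂ) * Complex.I =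
          c.arg * Complex.I + n * (θ k * Complex.I) := by
        have : (((k : ℝ) + 1) * Real.pi - η : ℝ) = c.arg + n * θ k := by
          rw [hθn]
          ring
        rw [this]
        push_cast
        ring
      rw [h1, h3, Complex.exp_add, Complex.exp_nat_mul, mul_pow]
      nth_rewrite 1 [← Complex.norm_mul_exp_arg_mul_I c]
      push_cast
      ring
    have h4 : Real.cos (((k : ℝ) + 1) * Real.pi - η) = -((-1) ^ k * Real.cos η) := by
      have := Real.cos_nat_mul_pi_sub η (k + 1)
      push_cast at this
      rw [this, pow_succ]
      ring
    simp only
    rw [h2, Complex.re_ofReal_mul, Complex.exp_ofReal_mul_I_re, h4]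
    have h5 : (0 : ℝ) < ‖c‖ * (w.im / Real.sin (θ k)) ^ n * Real.cos η := by
      have := norm_pos_iff.2 hc
      have := Real.cos_pos_of_mem_Ioo (x := η) ⟨by linarith, hη1⟩
      positivity
    have h6 : ((-1 : ℝ) ^ k) * (-1) ^ k = 1 := by
      rw [← mul_pow]
      simp
    calc (0 : ℝ) < _ := h5
      _ = (((-1 : ℝ) ^ k) * (-1) ^ k) * (‖c‖ * (w.im / Real.sin (θ k)) ^ n * Real.cos η) := by
        rw [h6, one_mul]
      _ = _ := by ring

lemma exists_alternatingValues {w c : ℂ} (hw : 0 < w.im) (hc : c ≠ 0) {n : ℕ} (hn : 0 < n) :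
    ∃ (x : ℕ → ℝ) (s : ℝ), s ≠ 0 ∧ (∀ j k, j < k → k < n → x k < x j) ∧
      AlternatingValues (fun t => s * (c * (t + w) ^ n).re) x n := by
  have key : ∀ c : ℂ, c ≠ 0 → (0 < c.im ∨ (c.im = 0 ∧ 0 ≤ c.re)) → 0 ≤ c.arg ∧ c.arg < Real.pi := by
    intro c _ h
    rw [Complex.arg_nonneg_iff, Complex.arg_lt_pi_iff]
    rcases h with h | ⟨h1, h2⟩
    · exact ⟨h.le, Or.inr h.ne'⟩
    · exact ⟨h1.ge, Or.inl h2⟩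
  by_cases h : 0 < c.im ∨ (c.im = 0 ∧ 0 ≤ c.re)
  · obtain ⟨x, hx, hv⟩ := exists_alternatingValues_of_arg hw hc (key c hc h).1 (key c hc h).2 hn
    exact ⟨x, -1, by norm_num, hx, fun k hk => by simpa using hv k hk⟩
  · have hc' : -c ≠ 0 := neg_ne_zero.2 hc
    have h' : 0 < (-c).im ∨ ((-c).im = 0 ∧ 0 ≤ (-c).re) := by
      simp only [Complex.neg_im, Complex.neg_re]
      push Not at h
      rcases lt_or_eq_of_le h.1 with h1 | h1
      · left; linarith
      · right
        exact ⟨by linarith, by linarith [h.2 h1]⟩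
    obtain ⟨x, hx, hv⟩ :=
      exists_alternatingValues_of_arg hw hc' (key _ hc' h').1 (key _ hc' h').2 hn
    exact ⟨x, 1, by norm_num, hx, fun k hk => by simpa using hv k hk⟩

/-! ### Necessity of the symbol conditions -/

/-- For small `ε` the polynomial `h + ε • p` is still hyperbolic, and `T` maps it to `ε • T p`. -/
lemma PreservesHyperbolicity.of_map_eq_zero {T : ℝ[X] →ₗ[ℝ] ℝ[X]}
    (hT : PreservesHyperbolicity T) {n : ℕ} (hn : 0 < n) {h : ℝ[X]} (hd : h.natDegree ≤ n)
    {x : ℕ → ℝ} (hx : ∀ j k, j < k → k < n → x k < x j)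
    (hv : AlternatingValues (fun t => h.eval t) x n) (h0 : T h = 0) {p : ℝ[X]}
    (hp : p.natDegree ≤ n) : Hyperbolic (T p) ∨ T p = 0 := by
  have hev : ∀ᶠ ε : ℝ in nhdsWithin 0 (Set.Ioi 0),
      AlternatingValues (fun t => (h + ε • p).eval t) x n := by
    have : ∀ᶠ ε : ℝ in nhds 0, ∀ k ∈ Finset.range n,
        0 < (-1) ^ k * (h + ε • p).eval (x k) := by
      rw [Filter.eventually_all_finset]
      intro k hk
      have hc : Continuous fun ε : ℝ => (-1) ^ k * (h + ε • p).eval (x k) := by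
        simp only [eval_add, eval_smul, smul_eq_mul]
        fun_prop
      refine hc.continuousAt.eventually (lt_mem_nhds ?_)
      simpa using hv k (Finset.mem_range.1 hk)
    filter_upwards [this.filter_mono nhdsWithin_le_nhds] with ε hε k hk
    exact hε k (Finset.mem_range.2 hk)
  obtain ⟨ε, hε, hε0⟩ := (hev.and self_mem_nhdsWithin).exists
  have hε' : ε ≠ 0 := (Set.mem_Ioi.1 hε0).ne'
  have hhyp := hyperbolic_of_alternatingValues hn
    (natDegree_add_le_of_degree_le hd ((natDegree_smul_le ε p).trans hp)) hx hε
  have hTp : T p = ε⁻¹ • T (h + ε • p) := by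
    rw [map_add, h0, zero_add, map_smul, inv_smul_smul₀ hε']
  rcases hT _ hhyp with h1 | h1
  · left
    rw [hTp]
    exact h1.smul (inv_ne_zero hε')
  · right
    rw [hTp, h1, smul_zero]

lemma exists_re_im_pow (w : ℂ) (n : ℕ) : ∃ f g : ℝ[X], f.natDegree ≤ n ∧ g.natDegree ≤ n ∧
    (X + C w) ^ n = f.map (algebraMap ℝ ℂ) + C Complex.I * g.map (algebraMap ℝ ℂ) ∧
    (X + C ((starRingEnd ℂ) w)) ^ n =
      f.map (algebraMap ℝ ℂ) - C Complex.I * g.map (algebraMap ℝ ℂ) := by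
  induction n with
  | zero => exact ⟨1, 0, by simp⟩
  | succ n ih =>
    obtain ⟨f, g, hf, hg, h1, h2⟩ := ih
    have hI : (C Complex.I * C Complex.I : ℂ[X]) = -1 := by
      rw [← C_mul, Complex.I_mul_I]
      simp
    have hw : C w = C (w.re : ℂ) + C (w.im : ℂ) * C Complex.I := by
      rw [← C_mul, ← C_add, Complex.re_add_im]
    have hw' : C ((starRingEnd ℂ) w) = C (w.re : ℂ) - C (w.im : ℂ) * C Complex.I := by
      rw [← C_mul, ← C_sub]
      congr 1
      apply Complex.ext <;> simp
    have hdeg : ∀ p q : ℝ[X], p.natDegree ≤ n → q.natDegree ≤ n → ∀ b : ℝ,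
        (p * (X + C w.re) + C b * q).natDegree ≤ n + 1 := by
      intro p q hp hq b
      refine natDegree_add_le_of_degree_le ?_
        ((natDegree_C_mul_le _ _).trans (hq.trans n.le_succ))
      refine natDegree_mul_le.trans ?_
      rw [natDegree_X_add_C]
      omega
    refine ⟨f * (X + C w.re) + C (-w.im) * g, g * (X + C w.re) + C w.im * f,
      hdeg f g hf hg _, hdeg g f hg hf _, ?_, ?_⟩
    · rw [pow_succ, h1, hw]
      simp only [Polynomial.map_add, Polynomial.map_mul, Polynomial.map_X, Polynomial.map_C,
        Complex.coe_algebraMap, C_neg, Polynomial.map_neg]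
      linear_combination (g.map (algebraMap ℝ ℂ) * C (w.im : ℂ)) * hI
    · rw [pow_succ, h2, hw']
      simp only [Polynomial.map_add, Polynomial.map_mul, Polynomial.map_X, Polynomial.map_C,
        Complex.coe_algebraMap, C_neg, Polynomial.map_neg]
      linear_combination (g.map (algebraMap ℝ ℂ) * C (w.im : ℂ)) * hI

lemma exists_real_combination_eq_zero {u v : ℂ} (h : u.im * v.re = u.re * v.im) :
    ∃ a b : ℝ, (a ≠ 0 ∨ b ≠ 0) ∧ a * u + b * v = 0 := by
  by_cases h1 : v.re = 0 ∧ u.re = 0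
  · by_cases h2 : v.im = 0 ∧ u.im = 0
    · exact ⟨1, 0, by simp, by apply Complex.ext <;> simp [h1, h2]⟩
    · refine ⟨v.im, -u.im, ?_, ?_⟩
      · simpa [imp_iff_not_or] using h2
      · apply Complex.ext <;> simp [h1]
        ring
  · refine ⟨v.re, -u.re, ?_, ?_⟩
    · simpa [imp_iff_not_or] using h1
    · apply Complex.ext <;> simp
      · ring
      · linarith

lemma continuous_symbol (A : ℂ[X] →ₗ[ℂ] ℂ[X]) (n : ℕ) :
    Continuous fun x : ℂ × ℂ => (A ((X + C x.2) ^ n)).eval x.1 := by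
  simp only [← evalComp_apply, ← eval_powPoly, powPoly, eval_finsetSum, eval_mul, eval_C,
    eval_pow, eval_X]
  simp only [evalComp_apply]
  fun_prop

theorem PreservesHyperbolicity.trichotomy {T : ℝ[X] →ₗ[ℝ] ℝ[X]}
    (hT : PreservesHyperbolicity T) {n : ℕ} (hn : 0 < n) :
    SymbolStable (complexify T) n ∨ SymbolStable (complexify (T ∘ₗ negArg)) n ∨
      ∀ p : ℝ[X], p.natDegree ≤ n → Hyperbolic (T p) ∨ T p = 0 := by
  set A := complexify T with hA
  set E : ℂ × ℂ → ℝ := fun x => Complex.normSq ((A ((X + C x.2) ^ n)).eval x.1) -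
    Complex.normSq ((A ((X + C ((starRingEnd ℂ) x.2)) ^ n)).eval x.1) with hE
  have hEc : Continuous E := by
    have h1 := continuous_symbol A n
    have h2 : Continuous fun x : ℂ × ℂ => (x.1, (starRingEnd ℂ) x.2) :=
      continuous_fst.prodMk (Complex.continuous_conj.comp continuous_snd)
    exact (Complex.continuous_normSq.comp h1).sub (Complex.continuous_normSq.comp (h1.comp h2))
  set S : Set (ℂ × ℂ) := {z : ℂ | 0 < z.im} ×ˢ {z : ℂ | 0 < z.im} with hS
  have hconn : IsPreconnected S :=
    ((convex_halfSpace_im_gt 0).prod (convex_halfSpace_im_gt 0)).isPreconnected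
  by_cases hzero : ∃ x ∈ S, E x = 0
  · right
    right
    obtain ⟨⟨z, w⟩, ⟨hz, hw⟩, h0⟩ := hzero
    simp only [Set.mem_ofPred_eq] at hz hw
    obtain ⟨f, g, hf, hg, h1, h2⟩ := exists_re_im_pow w n
    simp only [hE, h1, h2, map_add, map_sub, ← smul_eq_C_mul, map_smul, hA, complexify_map] at h0
    simp only [eval_add, eval_sub, eval_smul, smul_eq_mul, eval_map_algebraMap_complex,
      Complex.normSq_apply, Complex.add_re, Complex.add_im, Complex.sub_re, Complex.sub_im,
      Complex.mul_re, Complex.mul_im, Complex.I_re, Complex.I_im] at h0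
    obtain ⟨a, b, hab, hcomb⟩ := exists_real_combination_eq_zero
      (u := aeval z (T f)) (v := aeval z (T g)) (by linarith)
    -- On the real line `(t + w) ^ n = f + i g`, so `a f + b g` is the real part of `c * (t + w) ^
    -- n`.
    set c : ℂ := a - b * Complex.I with hc
    have hc0 : c ≠ 0 := by
      intro h
      have hre := congrArg Complex.re h
      have him := congrArg Complex.im h
      simp [hc] at hre him
      tauto
    obtain ⟨x, s, hs, hx, hv⟩ := exists_alternatingValues hw hc0 hn
    set h : ℝ[X] := s • (a • f + b • g) with hh
    have hval : ∀ t : ℝ, h.eval t = s * (c * (t + w) ^ n).re := by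
      intro t
      have h3 := congrArg (eval (t : ℂ)) h1
      rw [eval_pow, eval_add, eval_X, eval_C, eval_add, eval_mul, eval_C,
        eval_map_algebraMap_complex, eval_map_algebraMap_complex] at h3
      have h4 : ∀ p : ℝ[X], aeval (t : ℂ) p = ((p.eval t : ℝ) : ℂ) := fun p =>
        aeval_algebraMap_apply_eq_algebraMap_eval t p
      rw [h3, h4, h4, hh, hc]
      simp [mul_add]
    have hhd : h.natDegree ≤ n := (natDegree_smul_le _ _).trans
      (natDegree_add_le_of_degree_le ((natDegree_smul_le _ _).trans hf)
        ((natDegree_smul_le _ _).trans hg))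
    have hvh : AlternatingValues (fun t => h.eval t) x n := by
      simpa only [hval] using hv
    -- `T h` has the nonreal zero `z`, although `h` is hyperbolic.
    have hTh : T h = 0 := by
      refine (hT h (hyperbolic_of_alternatingValues hn hhd hx hvh)).resolve_left fun hyp => ?_
      refine hz.ne' (hyp.2 z ?_)
      rw [hh, map_smul, map_add, map_smul, map_smul, map_smul, map_add, map_smul, map_smul,
        Complex.real_smul (x := a), Complex.real_smul (x := b), hcomb, smul_zero]
    exact fun p hp => hT.of_map_eq_zero hn hhd hx hvh hTh hp
  · push Not at hzero
    have hsign : (∀ x ∈ S, 0 < E x) ∨ (∀ x ∈ S, E x < 0) := by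
      by_contra! hcon
      obtain ⟨⟨x, hx, hx0⟩, ⟨y, hy, hy0⟩⟩ := hcon
      obtain ⟨u, hu, hu0⟩ := hconn.intermediate_value hx hy hEc.continuousOn
        (show (0 : ℝ) ∈ _ from ⟨hx0, hy0⟩)
      exact hzero u hu hu0
    rcases hsign with hpos | hneg
    · refine Or.inl fun z w hz hw h => ?_
      have := hpos (z, w) ⟨hz, hw⟩
      simp only [hE, h, map_zero] at this
      linarith [Complex.normSq_nonneg ((A ((X + C ((starRingEnd ℂ) w)) ^ n)).eval z)]
    · refine Or.inr (Or.inl fun z w hz hw h => ?_)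
      rw [complexify_negArg, eval_smul, smul_eq_mul] at h
      have h1 : (A ((X + C (-w)) ^ n)).eval z = 0 := by
        rw [C_neg, ← sub_eq_add_neg]
        exact (mul_eq_zero.1 h).resolve_left (by simp)
      -- The reflected point `-w̄` again lies in the upper half-plane and its conjugate is `-w`, so
      -- the dominant term is the symbol at `-w`.
      have := hneg (z, -(starRingEnd ℂ) w) ⟨hz, by simpa using hw⟩
      simp only [hE] at this
      rw [map_neg (starRingEnd ℂ), Complex.conj_conj, h1, map_zero] at this
      linarith [Complex.normSq_nonneg ((A ((X + C (-(starRingEnd ℂ) w)) ^ n)).eval z)]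

end AlgHyp

namespace AlgHyp

/-! ### Arguments of products of linear factors -/

lemma Alternates.tail {x y : ℝ} {l m : List ℝ} (h : Alternates (x :: l) (y :: m)) :
    x ≤ y ∧ Alternates (y :: m) l := by
  obtain ⟨h1, h2, h3⟩ := h
  refine ⟨h2 0 (by simp) (by simp), ?_, fun i ha hb => ?_, fun i hb ha => ?_⟩
  · simp only [List.length_cons] at h1 ⊢
    omega
  · exact h3 i ha (by simpa using hb)
  · exact h2 (i + 1) (by simpa using hb) ha

/-- The alternating sum telescopes: deleting the first entry swaps the two lists and negates the
difference up to `θ x`, so the equal-length and longer-by-one cases feed each other. The equality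
clauses isolate the case of identical zeros. -/
lemma Alternates.sum_bounds {θ : ℝ → ℝ} (hθ : StrictMono θ) (h0 : ∀ x, 0 < θ x)
    (hπ : ∀ x, θ x < Real.pi) : ∀ (m l : List ℝ) (x : ℝ), Alternates (x :: l) m →
    (l.length + 1 = m.length → 0 ≤ (m.map θ).sum - ((x :: l).map θ).sum ∧
      (m.map θ).sum - ((x :: l).map θ).sum < Real.pi - θ x ∧
      ((m.map θ).sum - ((x :: l).map θ).sum = 0 → x :: l = m)) ∧
    (l.length = m.length → (m.map θ).sum - ((x :: l).map θ).sum ≤ -θ x ∧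
      -Real.pi < (m.map θ).sum - ((x :: l).map θ).sum ∧
      ((m.map θ).sum - ((x :: l).map θ).sum = -θ x → l = m))
  | [], l, x, _ => by
    refine ⟨fun h => by simp at h, fun h => ?_⟩
    obtain rfl := List.length_eq_zero_iff.1 h
    simpa using hπ x
  | y :: m, l, x, h => by
    obtain ⟨hxy, ht⟩ := h.tail
    have ih := sum_bounds hθ h0 hπ l m y ht
    have hθxy := hθ.monotone hxy
    simp only [List.map_cons, List.sum_cons, List.length_cons, Nat.add_right_cancel_iff] at ih ⊢
    refine ⟨fun hl => ?_, fun hl => ?_⟩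
    · obtain ⟨h1, h2, h3⟩ := ih.2 hl.symm
      refine ⟨by linarith, by linarith, fun he => ?_⟩
      have hxy' : x = y := hθ.injective (by linarith)
      rw [hxy', h3 (by linarith)]
    · obtain ⟨h1, h2, h3⟩ := ih.1 hl.symm
      exact ⟨by linarith, by linarith, fun he => (h3 (by linarith)).symm⟩
termination_by m l => m.length + l.length

/-- The sum of the arguments of `z - x`, where `x` runs through a list. -/
noncomputable def argSum (a : List ℝ) (z : ℂ) : ℝ :=
  (a.map fun x : ℝ => (z - x).arg).sum

lemma arg_mem_Ioo {z : ℂ} (hz : 0 < z.im) : 0 < z.arg ∧ z.arg < Real.pi := by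
  refine ⟨lt_of_le_of_ne (Complex.arg_nonneg_iff.2 hz.le) fun h => ?_,
    Complex.arg_lt_pi_iff.2 (Or.inr hz.ne')⟩
  exact hz.ne' (Complex.arg_eq_zero_iff.1 h.symm).2

/-- The sine of the difference of arguments is `z.im * (y - x)` over a product of norms, hence
positive. -/
lemma strictMono_arg_sub {z : ℂ} (hz : 0 < z.im) : StrictMono fun x : ℝ => (z - x).arg := by
  intro x y hxy
  have him : ∀ t : ℝ, 0 < (z - t).im := fun t => by simpa using hz
  have hx := arg_mem_Ioo (him x)
  have hy := arg_mem_Ioo (him y)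
  have hnx : 0 < ‖z - x‖ := norm_pos_iff.2 fun h => (him x).ne' (by rw [h]; simp)
  have hny : 0 < ‖z - y‖ := norm_pos_iff.2 fun h => (him y).ne' (by rw [h]; simp)
  have hsin : 0 < Real.sin ((z - y).arg - (z - x).arg) := by
    rw [Real.sin_sub, Complex.sin_arg, Complex.sin_arg, Complex.cos_arg (norm_pos_iff.1 hny),
      Complex.cos_arg (norm_pos_iff.1 hnx), div_mul_div_comm, div_mul_div_comm, ← sub_div]
    refine div_pos ?_ (mul_pos hny hnx)
    simp only [Complex.sub_im, Complex.sub_re, Complex.ofReal_im, Complex.ofReal_re, sub_zero]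
    nlinarith
  by_contra! hle
  have := Real.sin_nonpos_of_nonpos_of_neg_pi_le (x := (z - y).arg - (z - x).arg)
    (by linarith) (by linarith)
  linarith

lemma prod_eq_norm_mul_exp_argSum (a : List ℝ) (z : ℂ) :
    (a.map fun x : ℝ => z - x).prod =
      ‖(a.map fun x : ℝ => z - x).prod‖ * Complex.exp (argSum a z * Complex.I) := by
  induction a with
  | nil => simp [argSum]
  | cons x a ih =>
    have h1 : argSum (x :: a) z = (z - x).arg + argSum a z := by simp [argSum]
    rw [List.map_cons, List.prod_cons, norm_mul, h1]
    conv_lhs => rw [ih, ← Complex.norm_mul_exp_arg_mul_I (z - x)]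
    push_cast
    rw [add_mul, Complex.exp_add]
    ring

lemma Hyperbolic.exists_aeval_eq {f : ℝ[X]} (hf : Hyperbolic f) :
    ∃ c : ℝ, c ≠ 0 ∧ f = c • ((sortedZeros f).map fun x => X - C x).prod := by
  obtain ⟨q, hq, -, hroots⟩ := exists_prod_multiset_X_sub_C_mul f
  have hdeg : q.natDegree = 0 := by
    by_contra hne
    obtain ⟨z, hz⟩ := IsAlgClosed.exists_aeval_eq_zero ℂ q
      (fun h => hne (natDegree_eq_of_degree_eq_some h))
    have hzf : aeval z f = 0 := by rw [← hq, map_mul, hz, mul_zero]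
    have hre : z = algebraMap ℝ ℂ z.re := by
      apply Complex.ext <;> simp [hf.2 z hzf]
    have hq0 : q ≠ 0 := by
      rintro rfl
      exact hne natDegree_zero
    rw [hre, aeval_algebraMap_apply_eq_algebraMap_eval] at hz
    have : z.re ∈ q.roots := (mem_roots hq0).2 (by simpa using hz)
    simp [hroots] at this
  have hprod : ((sortedZeros f).map fun x => X - C x).prod =
      (f.roots.map fun x => X - C x).prod := by
    rw [← Multiset.prod_coe, ← Multiset.map_coe, sortedZeros, Multiset.sort_eq]
  rw [eq_C_of_natDegree_eq_zero hdeg] at hq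
  refine ⟨q.coeff 0, fun h => hf.1 ?_, ?_⟩
  · rw [← hq, h, C_0, mul_zero]
  · rw [hprod, smul_eq_C_mul, mul_comm, hq]

lemma aeval_list_prod (a : List ℝ) (z : ℂ) :
    aeval z (a.map fun x : ℝ => (X - C x : ℝ[X])).prod = (a.map fun x : ℝ => z - x).prod := by
  rw [map_list_prod, List.map_map]
  congr 1
  refine List.map_congr_left fun x _ => ?_
  simp

/-- The difference of the arguments of two hyperbolic polynomials. -/
noncomputable def argDiff (f g : ℝ[X]) (z : ℂ) : ℝ :=
  argSum (sortedZeros g) z - argSum (sortedZeros f) z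

/-- Both sides say that the two values are real multiples of each other. Leading coefficients may be
negative, so arguments matter only modulo π. -/
lemma sin_argDiff_eq_zero_iff {f g : ℝ[X]} (hf : Hyperbolic f) (hg : Hyperbolic g) {z : ℂ}
    (hz : 0 < z.im) : Real.sin (argDiff f g z) = 0 ↔
      (aeval z f).im * (aeval z g).re = (aeval z f).re * (aeval z g).im := by
  obtain ⟨c, hc, hfc⟩ := hf.exists_aeval_eq
  obtain ⟨d, hd, hgd⟩ := hg.exists_aeval_eq
  have key : ∀ {p : ℝ[X]}, Hyperbolic p → ∀ {e : ℝ}, e ≠ 0 →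
      p = e • ((sortedZeros p).map fun x => X - C x).prod →
      ∃ r : ℝ, r ≠ 0 ∧ (aeval z p).re = r * Real.cos (argSum (sortedZeros p) z) ∧
        (aeval z p).im = r * Real.sin (argSum (sortedZeros p) z) := by
    intro p hp e he hpe
    have h1 : aeval z p = ((e * ‖((sortedZeros p).map fun x : ℝ => z - x).prod‖ : ℝ) : ℂ) *
        Complex.exp (argSum (sortedZeros p) z * Complex.I) := by
      conv_lhs => rw [hpe, map_smul, aeval_list_prod, Complex.real_smul,
        prod_eq_norm_mul_exp_argSum]
      push_cast
      ring
    refine ⟨_, fun h => ?_, by rw [h1, Complex.re_ofReal_mul, Complex.exp_ofReal_mul_I_re],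
      by rw [h1, Complex.im_ofReal_mul, Complex.exp_ofReal_mul_I_im]⟩
    rw [h, Complex.ofReal_zero, zero_mul] at h1
    exact hz.ne' (hp.2 z h1)
  obtain ⟨r, hr, hr1, hr2⟩ := key hf hc hfc
  obtain ⟨s, hs, hs1, hs2⟩ := key hg hd hgd
  rw [hr1, hr2, hs1, hs2, argDiff, Real.sin_sub, ← sub_eq_zero (a := _ * _ * _)]
  have : r * Real.sin (argSum (sortedZeros f) z) * (s * Real.cos (argSum (sortedZeros g) z)) -
      r * Real.cos (argSum (sortedZeros f) z) * (s * Real.sin (argSum (sortedZeros g) z)) =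
      -(r * s) * (Real.sin (argSum (sortedZeros g) z) * Real.cos (argSum (sortedZeros f) z) -
        Real.cos (argSum (sortedZeros g) z) * Real.sin (argSum (sortedZeros f) z)) := by ring
  rw [this, mul_eq_zero, neg_eq_zero, mul_eq_zero]
  tauto

lemma hyperbolic_combination_of_alternates {f g : ℝ[X]} (hf : Hyperbolic f) (hg : Hyperbolic g)
    (h : Alternates (sortedZeros f) (sortedZeros g)) (a b : ℝ) :
    Hyperbolic (a • f + b • g) ∨ a • f + b • g = 0 := by
  have hmul : ∀ c : ℝ, ∀ p : ℝ[X], Hyperbolic p → Hyperbolic (c • p) ∨ c • p = 0 := by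
    intro c p hp
    by_cases hc : c = 0
    · right; rw [hc, zero_smul]
    · exact Or.inl (hp.smul hc)
  by_cases heq : sortedZeros f = sortedZeros g
  · obtain ⟨c, hc, hfc⟩ := hf.exists_aeval_eq
    obtain ⟨d, hd, hgd⟩ := hg.exists_aeval_eq
    have hgf : g = (d / c) • f := by
      conv_rhs => rw [hfc]
      rw [smul_smul, div_mul_cancel₀ _ hc, heq]
      exact hgd
    rw [hgf, smul_smul, ← add_smul]
    exact hmul _ f hf
  by_cases hb : b = 0
  · rw [hb, zero_smul, add_zero]
    exact hmul a f hf
  left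
  refine UpperNonvanishing.hyperbolic fun z hz h0 => ?_
  rw [eval_map_algebraMap_complex, map_add, map_smul, map_smul, Complex.real_smul,
    Complex.real_smul] at h0
  have hsin : Real.sin (argDiff f g z) = 0 := by
    rw [sin_argDiff_eq_zero_iff hf hg hz]
    have hre := congrArg Complex.re h0
    have him := congrArg Complex.im h0
    simp only [Complex.add_re, Complex.add_im, Complex.re_ofReal_mul, Complex.im_ofReal_mul,
      Complex.zero_re, Complex.zero_im] at hre him
    refine mul_left_cancel₀ hb ?_
    linear_combination (aeval z f).im * hre - (aeval z f).re * him
  have him : ∀ t : ℝ, 0 < (z - t).im := fun t => by simpa using hz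
  have hbd := Alternates.sum_bounds (strictMono_arg_sub hz) (fun x => (arg_mem_Ioo (him x)).1)
    (fun x => (arg_mem_Ioo (him x)).2)
  simp only [argDiff, argSum] at hsin
  rcases hsf : sortedZeros f with _ | ⟨x, l⟩
  · rw [hsf] at h heq
    have := h.1
    simp only [List.length_nil] at this
    exact heq (List.length_eq_zero_iff.1 (by omega)).symm
  · rw [hsf] at h heq hsin
    obtain ⟨h1, h2⟩ := hbd (sortedZeros g) l x h
    have hx := (arg_mem_Ioo (him x)).1
    rcases h.1 with hl | hl
    · obtain ⟨h3, h4, h5⟩ := h1 hl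
      rcases h3.eq_or_lt with h6 | h6
      · exact heq (h5 h6.symm)
      · exact (Real.sin_pos_of_pos_of_lt_pi h6 (by linarith)).ne' hsin
    · obtain ⟨h3, h4, h5⟩ := h2 (by simpa using hl)
      exact (Real.sin_neg_of_neg_of_neg_pi_lt (by linarith) h4).ne hsin

lemma hyperbolic_combination_of_zerosInterlace {f g : ℝ[X]} (hf : Hyperbolic f)
    (hg : Hyperbolic g) (h : ZerosInterlace f g) (a b : ℝ) :
    Hyperbolic (a • f + b • g) ∨ a • f + b • g = 0 := by
  rcases h with h | h
  · exact hyperbolic_combination_of_alternates hf hg h a b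
  · rw [add_comm]
    exact hyperbolic_combination_of_alternates hg hf h b a

/-! ### Interlacing from a pencil of hyperbolic polynomials -/

/-- The number of entries of a list that are larger than `x`. -/
noncomputable def countAbove (a : List ℝ) (x : ℝ) : ℕ :=
  a.countP fun r => decide (x < r)

lemma le_countAbove {a : List ℝ} (ha : a.Pairwise (· ≤ ·)) {i : ℕ} (hi : i < a.length) {x : ℝ}
    (hx : x < a[i]) : a.length - i ≤ countAbove a x := by
  have h1 : (a.drop i).countP (fun r => decide (x < r)) = (a.drop i).length := by
    rw [List.countP_eq_length]
    intro r hr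
    obtain ⟨j, hj, rfl⟩ := List.getElem_of_mem hr
    rw [List.getElem_drop]
    rw [List.length_drop] at hj
    have : a[i] ≤ a[i + j] := by
      rcases Nat.eq_zero_or_pos j with rfl | hj0
      · simp
      · exact List.pairwise_iff_getElem.1 ha i (i + j) hi (by omega) (by omega)
    simpa using hx.trans_le this
  rw [List.length_drop] at h1
  rw [← h1, countAbove]
  exact (List.drop_sublist i a).countP_le

lemma countAbove_lt {a : List ℝ} (ha : a.Pairwise (· ≤ ·)) {i : ℕ} (hi : i < a.length) {x : ℝ}
    (hx : a[i] ≤ x) : countAbove a x + i + 1 ≤ a.length := by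
  have h1 : (a.take (i + 1)).countP (fun r => decide (x < r)) = 0 := by
    rw [List.countP_eq_zero]
    intro r hr
    obtain ⟨j, hj, rfl⟩ := List.getElem_of_mem hr
    rw [List.getElem_take]
    rw [List.length_take] at hj
    have : a[j] ≤ a[i] := by
      rcases Nat.lt_or_ge j i with hj0 | hj0
      · exact List.pairwise_iff_getElem.1 ha j i (by omega) hi hj0
      · obtain rfl : j = i := by omega
        exact le_rfl
    simpa using this.trans hx
  have h2 := List.countP_append (p := fun r => decide (x < r)) (l₁ := a.take (i + 1))
    (l₂ := a.drop (i + 1))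
  rw [List.take_append_drop, h1, zero_add] at h2
  have h3 := List.countP_le_length (p := fun r => decide (x < r)) (l := a.drop (i + 1))
  rw [List.length_drop] at h3
  rw [countAbove, h2]
  omega

lemma exists_countAbove_eq_length (a b : List ℝ) :
    ∃ x, countAbove a x = a.length ∧ countAbove b x = b.length := by
  have h : ∀ᶠ x : ℝ in Filter.atBot, ∀ r ∈ (a ++ b).toFinset, x < r := by
    rw [Filter.eventually_all_finset]
    exact fun r _ => Filter.eventually_lt_atBot r
  obtain ⟨x, hx⟩ := h.exists
  refine ⟨x, ?_, ?_⟩ <;>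
  · rw [countAbove, List.countP_eq_length]
    intro r hr
    simpa using hx r (by simp [hr])

lemma exists_countAbove_eq_zero (a b : List ℝ) :
    ∃ x, countAbove a x = 0 ∧ countAbove b x = 0 := by
  have h : ∀ᶠ x : ℝ in Filter.atTop, ∀ r ∈ (a ++ b).toFinset, r < x := by
    rw [Filter.eventually_all_finset]
    exact fun r _ => Filter.eventually_gt_atTop r
  obtain ⟨x, hx⟩ := h.exists
  refine ⟨x, ?_, ?_⟩ <;>
  · rw [countAbove, List.countP_eq_zero]
    intro r hr
    simpa using (hx r (by simp [hr])).le

/-- Move slightly to the right: the strict inequality in `countAbove` makes the counts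
right-continuous. -/
lemma exists_notMem_countAbove_eq (a b : List ℝ) (x : ℝ) :
    ∃ y, y ∉ a ∧ y ∉ b ∧ countAbove a y = countAbove a x ∧ countAbove b y = countAbove b x := by
  have h : ∀ᶠ y : ℝ in nhdsWithin x (Set.Ioi x),
      ∀ r ∈ (a ++ b).toFinset, y ≠ r ∧ (y < r ↔ x < r) := by
    rw [Filter.eventually_all_finset]
    intro r _
    rcases lt_or_ge x r with hr | hr
    · filter_upwards [nhdsWithin_le_nhds (gt_mem_nhds hr)] with y hy
      exact ⟨ne_of_lt hy, by simp [hr, hy]⟩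
    · filter_upwards [self_mem_nhdsWithin] with y hy
      have hy' : r < y := hr.trans_lt hy
      exact ⟨hy'.ne', iff_of_false hy'.not_gt hr.not_gt⟩
  obtain ⟨y, hy⟩ := h.exists
  refine ⟨y, fun hm => (hy y (by simp [hm])).1 rfl, fun hm => (hy y (by simp [hm])).1 rfl, ?_, ?_⟩
  · exact List.countP_congr fun r hr => by simpa using (hy r (by simp [hr])).2
  · exact List.countP_congr fun r hr => by simpa using (hy r (by simp [hr])).2

lemma alternates_of_countAbove {a b : List ℝ} (ha : a.Pairwise (· ≤ ·)) (hb : b.Pairwise (· ≤ ·))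
    (h : ∀ x, countAbove a x ≤ countAbove b x ∧ countAbove b x ≤ countAbove a x + 1) :
    Alternates a b ∨ Alternates b a := by
  obtain ⟨x, hxa, hxb⟩ := exists_countAbove_eq_length a b
  have hx := h x
  rw [hxa, hxb] at hx
  rcases Nat.lt_or_ge a.length b.length with hl | hl
  · refine Or.inr ⟨by omega, fun i hib hia => ?_, fun i hia hib => ?_⟩ <;> by_contra! hlt
    · have h1 := le_countAbove hb hib hlt
      have h2 := countAbove_lt ha hia le_rfl
      have := h a[i]
      omega
    · have h1 := le_countAbove ha hia hlt
      have h2 := countAbove_lt hb hib le_rfl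
      have := h b[i + 1]
      omega
  · refine Or.inl ⟨by omega, fun i hia hib => ?_, fun i hib hia => ?_⟩ <;> by_contra! hlt
    · have h1 := le_countAbove ha hia hlt
      have h2 := countAbove_lt hb hib le_rfl
      have := h b[i]
      omega
    · have h1 := le_countAbove hb hib hlt
      have h2 := countAbove_lt ha hia le_rfl
      have := h a[i + 1]
      omega

/-- Seen from above the real line, each zero to the right of `x` contributes π and each zero to the
left contributes 0. Boundary arguments thus count zeros. -/
lemma tendsto_argSum {x : ℝ} (a : List ℝ) (hx : x ∉ a) :
    Filter.Tendsto (argSum a) (nhdsWithin (x : ℂ) {z : ℂ | 0 < z.im})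
      (nhds (countAbove a x * Real.pi)) := by
  induction a with
  | nil =>
    have h : argSum [] = fun _ => 0 := by
      funext z
      simp [argSum]
    rw [h]
    simpa [countAbove] using tendsto_const_nhds
  | cons r a ih =>
    have hxr : x ≠ r := fun h => hx (by simp [h])
    have h1 : argSum (r :: a) = fun z : ℂ => (z - r).arg + argSum a z := by
      funext z
      simp [argSum]
    have h2 : (countAbove (r :: a) x : ℝ) * Real.pi =
        (if x < r then Real.pi else 0) + countAbove a x * Real.pi := by
      simp only [countAbove, List.countP_cons]
      split_ifs <;> simp_all
      ring
    rw [h1, h2]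
    refine Filter.Tendsto.add ?_ (ih fun h => hx (by simp [h]))
    have hsub : Filter.Tendsto (fun z : ℂ => z - r) (nhdsWithin (x : ℂ) {z : ℂ | 0 < z.im})
        (nhdsWithin ((x : ℂ) - r) {z : ℂ | 0 ≤ z.im}) := by
      refine tendsto_nhdsWithin_iff.2 ⟨?_, ?_⟩
      · exact ((continuous_id.sub continuous_const).tendsto _).mono_left nhdsWithin_le_nhds
      · filter_upwards [self_mem_nhdsWithin] with z hz
        have : 0 < z.im := hz
        simpa using this.le
    split_ifs with hlt
    · exact (Complex.tendsto_arg_nhdsWithin_im_nonneg_of_re_neg_of_im_zero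
        (z := (x : ℂ) - r) (by simpa using hlt) (by simp)).comp hsub
    · have hpos : 0 < x - r := sub_pos.2 (lt_of_le_of_ne (not_lt.1 hlt) hxr.symm)
      have hc : ContinuousAt Complex.arg ((x : ℂ) - r) :=
        Complex.continuousAt_arg (Or.inl (by simpa using hpos))
      have harg : ((x : ℂ) - r).arg = 0 := by
        rw [← Complex.ofReal_sub]
        exact Complex.arg_ofReal_of_nonneg hpos.le
      have := hc.tendsto
      rw [harg] at this
      exact (this.mono_left nhdsWithin_le_nhds).comp hsub

lemma continuousOn_argSum (a : List ℝ) : ContinuousOn (argSum a) {z : ℂ | 0 < z.im} := by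
  induction a with
  | nil =>
    have h : argSum [] = fun _ => 0 := by
      funext z
      simp [argSum]
    rw [h]
    exact continuousOn_const
  | cons r a ih =>
    have h1 : argSum (r :: a) = fun z : ℂ => (z - r).arg + argSum a z := by
      funext z
      simp [argSum]
    rw [h1]
    refine ContinuousOn.add (fun z hz => ContinuousAt.continuousWithinAt ?_) ih
    have hz' : 0 < z.im := hz
    have hsl : z - r ∈ Complex.slitPlane := Or.inr (by simpa using hz'.ne')
    exact ContinuousAt.comp (f := fun z : ℂ => z - r) (Complex.continuousAt_arg hsl)
      (by fun_prop)

lemma pairwise_sortedZeros (f : ℝ[X]) : (sortedZeros f).Pairwise (· ≤ ·) :=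
  Multiset.pairwise_sort _ _

/-- Independence and hyperbolicity of the pencil keep `argDiff` off the multiples of π, so by
connectedness it stays between two consecutive ones. Its boundary values then force the zero counts
to differ by `k` or `k + 1` at every real point. -/
theorem zerosInterlace_of_pencil {f g : ℝ[X]} (hf : Hyperbolic f) (hg : Hyperbolic g)
    (hlin : ∀ a b : ℝ, a • f + b • g = 0 → a = 0 ∧ b = 0)
    (h : ∀ a b : ℝ, Hyperbolic (a • f + b • g) ∨ a • f + b • g = 0) : ZerosInterlace f g := by
  set S : Set ℂ := {z : ℂ | 0 < z.im} with hS
  have hsin : ∀ z ∈ S, Real.sin (argDiff f g z) ≠ 0 := by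
    intro z hz h0
    rw [sin_argDiff_eq_zero_iff hf hg hz] at h0
    obtain ⟨a, b, hab, hcomb⟩ := exists_real_combination_eq_zero h0
    rcases h a b with h1 | h1
    · have hz' : 0 < z.im := hz
      refine hz'.ne' (h1.2 z ?_)
      rw [map_add, map_smul, map_smul, Complex.real_smul, Complex.real_smul, hcomb]
    · have := hlin a b h1
      tauto
  have hcont : ContinuousOn (argDiff f g) S :=
    (continuousOn_argSum _).sub (continuousOn_argSum _)
  have hconn : IsPreconnected S := (convex_halfSpace_im_gt 0).isPreconnected
  have hI : Complex.I ∈ S := by simp [hS]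
  have hpi := Real.pi_pos
  set k : ℤ := ⌊argDiff f g Complex.I / Real.pi⌋ with hk
  have hk1 : k * Real.pi ≤ argDiff f g Complex.I :=
    (le_div_iff₀ hpi).1 (Int.floor_le _)
  have hk2 : argDiff f g Complex.I ≤ ((k + 1 : ℤ) : ℝ) * Real.pi := by
    have := ((div_lt_iff₀ hpi).1 (Int.lt_floor_add_one (argDiff f g Complex.I / Real.pi))).le
    push_cast
    exact this
  have hne : ∀ z ∈ S, ∀ j : ℤ, argDiff f g z ≠ j * Real.pi := fun z hz j hj =>
    hsin z hz (by rw [hj, Real.sin_int_mul_pi])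
  have hbound : ∀ z ∈ S, k * Real.pi ≤ argDiff f g z ∧
      argDiff f g z ≤ ((k + 1 : ℤ) : ℝ) * Real.pi := by
    intro z hz
    constructor <;> by_contra! hlt
    · obtain ⟨u, hu, hu'⟩ := hconn.intermediate_value hz hI hcont ⟨hlt.le, hk1⟩
      exact hne u hu _ hu'
    · obtain ⟨u, hu, hu'⟩ := hconn.intermediate_value hI hz hcont ⟨hk2, hlt.le⟩
      exact hne u hu _ hu'
  set a := sortedZeros f with ha
  set b := sortedZeros g with hb
  have hcount : ∀ x, k ≤ (countAbove b x : ℤ) - countAbove a x ∧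
      (countAbove b x : ℤ) - countAbove a x ≤ k + 1 := by
    intro x
    obtain ⟨y, hya, hyb, hca, hcb⟩ := exists_notMem_countAbove_eq a b x
    rw [← hca, ← hcb]
    have hlim : Filter.Tendsto (argDiff f g) (nhdsWithin (y : ℂ) S)
        (nhds (countAbove b y * Real.pi - countAbove a y * Real.pi)) :=
      (tendsto_argSum b hyb).sub (tendsto_argSum a hya)
    have hnebot : (nhdsWithin (y : ℂ) S).NeBot := by
      rw [← mem_closure_iff_nhdsWithin_neBot, hS, Complex.closure_setOfPred_lt_im]
      simp
    have h1 := ge_of_tendsto hlim (by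
      filter_upwards [self_mem_nhdsWithin] with z hz using (hbound z hz).1)
    have h2 := le_of_tendsto hlim (by
      filter_upwards [self_mem_nhdsWithin] with z hz using (hbound z hz).2)
    rw [← sub_mul] at h1 h2
    have h3 := le_of_mul_le_mul_right h1 hpi
    have h4 := le_of_mul_le_mul_right h2 hpi
    exact ⟨by exact_mod_cast h3, by exact_mod_cast h4⟩
  -- To the right of all zeros both counts are 0, which leaves only `k = 0` and `k = -1`.
  obtain ⟨x, hxa, hxb⟩ := exists_countAbove_eq_zero a b
  have hx := hcount x
  rw [hxa, hxb] at hx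
  have hk01 : k = 0 ∨ k = -1 := by omega
  rcases hk01 with hk0 | hk0
  · refine alternates_of_countAbove (pairwise_sortedZeros f) (pairwise_sortedZeros g) fun x => ?_
    have : _ ∧ _ := hcount x
    rw [← ha, ← hb]
    omega
  · refine (alternates_of_countAbove (pairwise_sortedZeros g) (pairwise_sortedZeros f)
      fun x => ?_).symm
    have : _ ∧ _ := hcount x
    rw [← ha, ← hb]
    omega

lemma zerosInterlace_self (f : ℝ[X]) : ZerosInterlace f f := by
  refine Or.inl ⟨Or.inl rfl, fun i _ _ => le_rfl, fun i hb ha => ?_⟩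
  exact List.pairwise_iff_getElem.1 (pairwise_sortedZeros f) i (i + 1) hb ha i.lt_succ_self

/-! ### Operators whose range consists of hyperbolic polynomials -/

/-- No hyperbolic polynomial vanishes at `i`, so evaluation there embeds the range into ℂ. -/
theorem rank_le_two_of_range {T : ℝ[X] →ₗ[ℝ] ℝ[X]} (h : ∀ p, Hyperbolic (T p) ∨ T p = 0) :
    Module.rank ℝ (LinearMap.range T) ≤ 2 := by
  rw [← Complex.rank_real_complex]
  refine LinearMap.rank_le_of_injective
    ((aeval Complex.I : ℝ[X] →ₐ[ℝ] ℂ).toLinearMap ∘ₗ (LinearMap.range T).subtype) ?_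
  rw [← LinearMap.ker_eq_bot, LinearMap.ker_eq_bot']
  rintro ⟨_, p, rfl⟩ hp
  have hp' : aeval Complex.I (T p) = 0 := hp
  refine Subtype.ext ((h p).resolve_left fun hyp => ?_)
  simpa using hyp.2 _ hp'

theorem exists_interlacing_of_range {T : ℝ[X] →ₗ[ℝ] ℝ[X]}
    (h : ∀ p, Hyperbolic (T p) ∨ T p = 0) :
    ∃ (α β : ℝ[X] →ₗ[ℝ] ℝ) (P Q : ℝ[X]), Hyperbolic P ∧ Hyperbolic Q ∧ ZerosInterlace P Q ∧
      ∀ f : ℝ[X], T f = α f • P + β f • Q := by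
  have hI : ∀ p, aeval Complex.I (T p) = 0 → T p = 0 := fun p hp =>
    (h p).resolve_left fun hyp => by simpa using hyp.2 _ hp
  by_cases h0 : ∀ p, T p = 0
  · have h1 : Hyperbolic (1 : ℝ[X]) := ⟨one_ne_zero, fun z hz => by simp at hz⟩
    exact ⟨0, 0, 1, 1, h1, h1, zerosInterlace_self 1, fun f => by simp [h0]⟩
  push Not at h0
  obtain ⟨p, hp⟩ := h0
  have hP := (h p).resolve_right hp
  set u : ℂ := aeval Complex.I (T p) with hu
  have hu0 : u ≠ 0 := fun h => hp (hI p h)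
  by_cases h1 : ∀ f, ∃ c : ℝ, T f = c • T p
  · refine ⟨Complex.reLm ∘ₗ LinearMap.mulLeft ℝ u⁻¹ ∘ₗ
      (aeval Complex.I : ℝ[X] →ₐ[ℝ] ℂ).toLinearMap ∘ₗ T, 0, T p, T p, hP, hP,
      zerosInterlace_self _, fun f => ?_⟩
    obtain ⟨c, hc⟩ := h1 f
    simp only [LinearMap.comp_apply, hc, LinearMap.zero_apply, zero_smul, add_zero,
      AlgHom.toLinearMap_apply, map_smul, ← hu]
    simp [hu0]
  · push Not at h1
    obtain ⟨q, hq⟩ := h1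
    have hQ : Hyperbolic (T q) := (h q).resolve_right fun h => hq 0 (by rw [h, zero_smul])
    have hlin : ∀ a b : ℝ, a • T p + b • T q = 0 → a = 0 ∧ b = 0 := by
      intro a b hab
      have hb : b = 0 := by
        by_contra hb
        refine hq (-(b⁻¹ * a)) ?_
        have h2 : b • T q = -(a • T p) := by rw [eq_neg_iff_add_eq_zero, add_comm, hab]
        rw [neg_smul, mul_smul, ← smul_neg, ← h2, inv_smul_smul₀ hb]
      rw [hb, zero_smul, add_zero] at hab
      exact ⟨(smul_eq_zero.1 hab).resolve_right hp, hb⟩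
    have hcomb : ∀ a b : ℝ, Hyperbolic (a • T p + b • T q) ∨ a • T p + b • T q = 0 := by
      intro a b
      simpa using h (a • p + b • q)
    set v : ℂ := aeval Complex.I (T q) with hv
    have hD : u.im * v.re - u.re * v.im ≠ 0 := by
      intro hD
      obtain ⟨a, b, hab, h2⟩ := exists_real_combination_eq_zero (sub_eq_zero.1 hD)
      have h3 := hI (a • p + b • q) (by
        rw [map_add, map_smul, map_smul, map_add, map_smul, map_smul, Complex.real_smul,
          Complex.real_smul, ← hu, ← hv, h2])
      rw [map_add, map_smul, map_smul] at h3
      have := hlin a b h3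
      tauto
    set D : ℝ := u.im * v.re - u.re * v.im with hDdef
    set L : ℝ[X] →ₗ[ℝ] ℂ := (aeval Complex.I : ℝ[X] →ₐ[ℝ] ℂ).toLinearMap ∘ₗ T with hL
    -- Cramer's rule: the coordinates of `(T f)(i)` in the real basis `u`, `v` of ℂ, with
    -- determinant `D`.
    refine ⟨D⁻¹ • (Complex.imLm ∘ₗ LinearMap.mulLeft ℝ ((starRingEnd ℂ) v) ∘ₗ L),
      -D⁻¹ • (Complex.imLm ∘ₗ LinearMap.mulLeft ℝ ((starRingEnd ℂ) u) ∘ₗ L), T p, T q, hP, hQ,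
      zerosInterlace_of_pencil hP hQ hlin hcomb, fun f => ?_⟩
    set a : ℝ := (D⁻¹ • (Complex.imLm ∘ₗ LinearMap.mulLeft ℝ ((starRingEnd ℂ) v) ∘ₗ L)) f with ha
    set b : ℝ := (-D⁻¹ • (Complex.imLm ∘ₗ LinearMap.mulLeft ℝ ((starRingEnd ℂ) u) ∘ₗ L)) f
      with hb
    set t : ℂ := aeval Complex.I (T f) with ht
    have ha' : a = D⁻¹ * (v.re * t.im - v.im * t.re) := by
      simp only [ha, hL, LinearMap.smul_apply, LinearMap.comp_apply, AlgHom.toLinearMap_apply,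
        ← ht, LinearMap.mulLeft_apply, Complex.imLm_coe, Complex.mul_im, Complex.conj_re,
        Complex.conj_im, smul_eq_mul]
      ring
    have hb' : b = -D⁻¹ * (u.re * t.im - u.im * t.re) := by
      simp only [hb, hL, LinearMap.smul_apply, LinearMap.comp_apply, AlgHom.toLinearMap_apply,
        ← ht, LinearMap.mulLeft_apply, Complex.imLm_coe, Complex.mul_im, Complex.conj_re,
        Complex.conj_im, smul_eq_mul]
      ring
    have h2 := hI (f - (a • p + b • q)) (by
      rw [map_sub, map_sub, map_add, map_add, map_smul, map_smul, map_smul, map_smul,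
        Complex.real_smul, Complex.real_smul, ← hu, ← hv, ← ht, ha', hb']
      apply Complex.ext <;> simp only [Complex.sub_re, Complex.sub_im, Complex.add_re,
        Complex.add_im, Complex.re_ofReal_mul, Complex.im_ofReal_mul, Complex.zero_re,
        Complex.zero_im] <;> field_simp <;> rw [hDdef] <;> ring)
    rw [map_sub, map_add, map_smul, map_smul] at h2
    exact sub_eq_zero.1 h2

end AlgHyp

/-! ### The characterization -/

theorem corollary2p6 (T : ℝ[X] →ₗ[ℝ] ℝ[X]) :
    AlgHyp.PreservesHyperbolicity T ↔
      ((Module.rank ℝ (LinearMap.range T) ≤ 2 ∧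
          ∃ (α β : ℝ[X] →ₗ[ℝ] ℝ) (P Q : ℝ[X]),
            AlgHyp.Hyperbolic P ∧ AlgHyp.Hyperbolic Q ∧ AlgHyp.ZerosInterlace P Q ∧
              ∀ f : ℝ[X], T f = α f • P + β f • Q) ∨
        (∀ n : ℕ,
          AlgHyp.RealStable
              (AlgHyp.extend T ((MvPolynomial.X 0 + MvPolynomial.X 1) ^ n)) ∨
            AlgHyp.extend T ((MvPolynomial.X 0 + MvPolynomial.X 1) ^ n) = 0) ∨
        (∀ n : ℕ,
          AlgHyp.RealStable
              (AlgHyp.extend T ((MvPolynomial.X 0 - MvPolynomial.X 1) ^ n)) ∨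
            AlgHyp.extend T ((MvPolynomial.X 0 - MvPolynomial.X 1) ^ n) = 0)) := by
  simp only [AlgHyp.realStable_add_iff, AlgHyp.realStable_sub_iff]
  constructor
  · intro hT
    by_contra! hcon
    obtain ⟨ha, ⟨n₁, hb⟩, ⟨n₂, hc⟩⟩ := hcon
    have hrange : ∀ p, AlgHyp.Hyperbolic (T p) ∨ T p = 0 := by
      intro p
      -- Large enough that either stable symbol would descend to a failing index `n₁` or `n₂`, and
      -- that the third alternative covers `p`.
      have hn : 0 < n₁ + n₂ + p.natDegree + 1 := by omega
      rcases hT.trichotomy hn with h | h | h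
      · exact absurd (AlgHyp.symbol_of_le (m := n₁) (by omega) (Or.inl h)) (not_or.2 hb)
      · exact absurd (AlgHyp.symbol_of_le (m := n₂) (by omega) (Or.inl h)) (not_or.2 hc)
      · exact h p (by omega)
    obtain ⟨α, β, P, Q, hP, hQ, hPQ, hf⟩ := AlgHyp.exists_interlacing_of_range hrange
    obtain ⟨f, hne⟩ := ha (AlgHyp.rank_le_two_of_range hrange) α β P Q hP hQ hPQ
    exact hne (hf f)
  · rintro (⟨-, α, β, P, Q, hP, hQ, hPQ, hf⟩ | h | h)
    · intro f _
      rw [hf f]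
      exact AlgHyp.hyperbolic_combination_of_zerosInterlace hP hQ hPQ _ _
    · exact AlgHyp.preservesHyperbolicity_of_symbol h
    · exact AlgHyp.preservesHyperbolicity_of_negArg (AlgHyp.preservesHyperbolicity_of_symbol h)
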